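/- Setting. Let $E=\mathbb R^d$ with an inner product $[\cdot,\cdot]$, let $V\subseteq E$ be a linear subspace, $x_0\in V^\perp$, $U=V+x_0$ and $W=E/V^\perp$, with the pairing $\langle w,u\rangle=[w,u-x_0]$ for $w\in W$, $u\in U$; identify $W$ with $V$ (hence give it the inner product of $V$) by taking representatives in $V$. Let $\mathcal H$ be a finite set of linear hyperplanes of $W$ with $\bigcap\mathcal H=\{0\}$ such that the group $\mathfrak G\subseteq GL(W)$ generated by the orthogonal reflections in the members of $\mathcal H$ is finite and $\mathcal H$ consists of all reflecting hyperplanes of $\mathfrak G$. Let $\mathfrak G$ act on $U$ from the right by $\langle gw,u\rangle=\langle w,ug\rangle$. Let $\Phi$ be a (closed) chamber of the fan of $\mathcal H$ and $\Psi=\{u\in U: u+V^\perp\in\Phi\}$. Write $K^\circ$ for the relative interior of $K$, $\Sigma(\Phi)$ for the set of nonempty faces of $\Phi$, and $\mathfrak G_\phi=\{g\in\mathfrak G: g\phi=\phi\}$. For a polytope $P\subseteq U$ let $\mathfrak G(P)=\operatorname{Conv}\{xg: x\in P,\ g\in\mathfrak G\}$, let $f_i(P)$ be the number of $i$-dimensional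 faces of $P$, and let $\Sigma(P)$ be the normal fan of $P$ in $W$, that is, the set of the cones $\{w\in W:\langle w,y\rangle\ge\langle w,y'\rangle\ \forall y\in F,\ y'\in P\}$ over all nonempty faces $F$ of $P$. $P$ is called $\Phi$-placed if some $\gamma\in\Phi^\circ$ has $\langle\gamma,\cdot\rangle$ constant on $P$, and $\Psi$-appropriate if $P\subseteq\Psi^\circ$. Let $\mathrm{FFan}(P)$ be the set of all nonempty faces of the cones $\sigma\cap\Phi$, $\sigma\in\Sigma(P)$; for $\phi\in\Sigma(\Phi)$ let $\mathrm{FFan}(P,\phi)$ be the set of those $\tau\in\mathrm{FFan}(P)$ for which $\phi$ is the inclusion-minimal face of $\Phi$ containing $\tau$, and let $f^i(\mathrm{FFan}(P,\phi))$ be the number of cones of codimension $i$ (in $W$) in it. Proposition. Let $P\subseteq U$ be a $\Phi$-placed and $\Psi$-appropriate polytope. Then $\mathfrak G(P)$ has finitely many faces, $\mathrm{FFan}(P)$ and $\Sigma(\Phi)$ are finite, and for every integer $i\ge 0$ $$f_i(\mathfrak G(P))=\sum_{\substack{\phi\in\Sigma(\Phi)\\ \operatorname{codim}\phi\le i}}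 f^i(\mathrm{FFan}(P,\phi))\cdot\frac{|\mathfrak G|}{|\mathfrak G_\phi|}.$$ -/

import Mathlib

open scoped Pointwise

noncomputable section

namespace Symmetrization

section Setting

variable {E : Type*} [NormedAddCommGroup E] [InnerProductSpace ℝ E] [FiniteDimensional ℝ E]

/-- The dual space `W = E / Vᗮ` of a linear subspace `V` of the Euclidean space `E`. -/
abbrev DualSpace (V : Submodule ℝ E) : Type _ := E ⧸ Vᗮ

/-- The unique representative in `V` of a class `w ∈ W = E / Vᗮ`, as a linear isomorphism. -/
def toV (V : Submodule ℝ E) : DualSpace V ≃ₗ[ℝ] V :=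
  Submodule.quotientEquivOfIsCompl Vᗮ V
    (Submodule.isCompl_orthogonal (K := V)).symm

/-- The translate `U = V + x₀` of `V`. -/
def affineTranslate (V : Submodule ℝ E) (x₀ : E) : Set E := {u | u - x₀ ∈ V}

/-- The pairing `⟨w, u⟩ = [w, u - x₀]` between `W` and `U = V + x₀`; the inner product does not
depend on the representative of `w` for `u ∈ U` (see `pairing_mk`), and the one in `V` is used. -/
def pairing (V : Submodule ℝ E) (x₀ : E) (w : DualSpace V) (u : E) : ℝ :=
  inner ℝ ((toV V w : V) : E) (u - x₀)

theorem sub_toV_mk_mem (V : Submodule ℝ E) (y : E) :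
    y - ((toV V (Submodule.Quotient.mk y) : V) : E) ∈ Vᗮ := by
  have h : (Submodule.Quotient.mk y : DualSpace V)
      = Submodule.Quotient.mk ((toV V (Submodule.Quotient.mk y) : V) : E) := by
    have := (toV V).symm_apply_apply (Submodule.Quotient.mk y)
    conv_lhs => rw [← this]
    exact Submodule.quotientEquivOfIsCompl_symm_apply _ _ _ _
  exact (Submodule.Quotient.eq _).1 h

theorem pairing_mk (V : Submodule ℝ E) (x₀ : E) (y u : E) (hu : u ∈ affineTranslate V x₀) :
    pairing V x₀ (Submodule.Quotient.mk y) u = inner ℝ y (u - x₀) := by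
  have h := (Submodule.mem_orthogonal' V _).1 (sub_toV_mk_mem V y) (u - x₀) hu
  rw [inner_sub_left] at h
  unfold pairing
  linarith

/-- The nonempty faces of `P ⊆ U`: the sets of maximisers on `P` of the functionals `⟨w, ·⟩`. -/
def faces (V : Submodule ℝ E) (x₀ : E) (P : Set E) : Set (Set E) :=
  {F | F.Nonempty ∧ ∃ w : DualSpace V,
    F = {x ∈ P | ∀ y ∈ P, pairing V x₀ w y ≤ pairing V x₀ w x}}

/-- The nonempty faces of `K ⊆ W`: the sets of maximisers on `K` of the linear functionals on `W`.
For `K = Φ` this is `Σ(Φ)`. -/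
def coneFaces (V : Submodule ℝ E) (K : Set (DualSpace V)) : Set (Set (DualSpace V)) :=
  {F | F.Nonempty ∧ ∃ l : DualSpace V →ₗ[ℝ] ℝ, F = {w ∈ K | ∀ w' ∈ K, l w' ≤ l w}}

/-- The (affine) dimension of a nonempty subset of a real vector space. -/
def dim {M : Type*} [AddCommGroup M] [Module ℝ M] (S : Set M) : ℕ :=
  Module.finrank ℝ (vectorSpan ℝ S)

/-- `f_i(P)`, the number of `i`-dimensional faces of `P ⊆ U`. -/
def faceNumber (V : Submodule ℝ E) (x₀ : E) (P : Set E) (i : ℕ) : ℕ :=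
  {F ∈ faces V x₀ P | dim F = i}.ncard

/-- `f^i(C)`, the number of cones of codimension `i` in a collection `C` of cones in `W`. -/
def codimNumber (V : Submodule ℝ E) (C : Set (Set (DualSpace V))) (i : ℕ) : ℕ :=
  {σ ∈ C | dim σ + i = Module.finrank ℝ (DualSpace V)}.ncard

/-- `P` is a polytope in `U = V + x₀`. -/
def IsPolytope (V : Submodule ℝ E) (x₀ : E) (P : Set E) : Prop :=
  ∃ s : Set E, s.Finite ∧ s ⊆ affineTranslate V x₀ ∧ P = convexHull ℝ s

/-- The normal cone of `P` at `F` with respect to `W`. -/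
def ncone (V : Submodule ℝ E) (x₀ : E) (F P : Set E) : Set (DualSpace V) :=
  {w | ∀ y ∈ F, ∀ y' ∈ P, pairing V x₀ w y' ≤ pairing V x₀ w y}

/-- The normal fan `Σ(P)` of `P` with respect to `W`. -/
def normalFan (V : Submodule ℝ E) (x₀ : E) (P : Set E) : Set (Set (DualSpace V)) :=
  {σ | ∃ F ∈ faces V x₀ P, σ = ncone V x₀ F P}

/-- The perpendicular space `P^∨` of `P`. -/
def perp (V : Submodule ℝ E) (x₀ : E) (P : Set E) : Set (DualSpace V) :=
  {w | ∀ x ∈ P, ∀ y ∈ P, pairing V x₀ w x = pairing V x₀ w y}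

/-- The orthogonal reflection of `W` in the hyperplane `H`, the inner product on `W` being the one
of `V` under the identification of `W` with `V`. -/
def reflectionIn (V : Submodule ℝ E) (H : Submodule ℝ (DualSpace V)) :
    DualSpace V ≃ₗ[ℝ] DualSpace V :=
  (toV V).trans
    (((H.map (toV V).toLinearMap).reflection.toLinearEquiv).trans (toV V).symm)

/-- The group generated by the reflections in the hyperplanes of an arrangement. -/
def reflectionGroup (V : Submodule ℝ E) (𝓗 : Set (Submodule ℝ (DualSpace V))) :
    Subgroup (DualSpace V ≃ₗ[ℝ] DualSpace V) :=
  Subgroup.closure (reflectionIn V '' 𝓗)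

/-- `𝓗` is the hyperplane arrangement of a finite reflection group on `W`: a finite set of linear
hyperplanes meeting only in the origin, generating a finite group, and consisting of all the
reflecting hyperplanes of that group. -/
structure IsReflectionArrangement (V : Submodule ℝ E)
    (𝓗 : Set (Submodule ℝ (DualSpace V))) : Prop where
  finite : 𝓗.Finite
  hyperplane : ∀ H ∈ 𝓗, IsCoatom H
  essential : sInf 𝓗 = ⊥
  finite_group : Finite (reflectionGroup V 𝓗)
  determined : ∀ H : Submodule ℝ (DualSpace V), IsCoatom H →
    reflectionIn V H ∈ reflectionGroup V 𝓗 → H ∈ 𝓗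

/-- The smallest cone of `Σ(𝓗)` that contains `w`: the points lying, with respect to each
hyperplane of `𝓗`, weakly on the same side as `w`, and on the hyperplane if `w` does. -/
def arrangementCone (V : Submodule ℝ E) (𝓗 : Set (Submodule ℝ (DualSpace V)))
    (w : DualSpace V) : Set (DualSpace V) :=
  {w' | ∀ l : DualSpace V →ₗ[ℝ] ℝ, LinearMap.ker l ∈ 𝓗 → 0 ≤ l w → 0 ≤ l w'}

/-- The fan `Σ(𝓗)` induced by the arrangement `𝓗`. -/
def arrangementFan (V : Submodule ℝ E) (𝓗 : Set (Submodule ℝ (DualSpace V))) :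
    Set (Set (DualSpace V)) :=
  Set.range (arrangementCone V 𝓗)

/-- `Φ` is a chamber of `Σ(𝓗)`, that is, a full-dimensional cone of this complete fan. -/
def IsChamber (V : Submodule ℝ E) (𝓗 : Set (Submodule ℝ (DualSpace V)))
    (Φ : Set (DualSpace V)) : Prop :=
  Φ ∈ arrangementFan V 𝓗 ∧ dim Φ = Module.finrank ℝ (DualSpace V)

/-- The cone `Ψ = Φ^*` in `U`: the points `u ∈ U` whose class in `W` lies in `Φ`. -/
def dualChamber (V : Submodule ℝ E) (x₀ : E) (Φ : Set (DualSpace V)) : Set E :=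
  {u | u ∈ affineTranslate V x₀ ∧ (Submodule.Quotient.mk u : DualSpace V) ∈ Φ}

/-- The right action `u ↦ u g` on `U = V + x₀` that is dual to the left action on `W`
(see `pairing_rightAct`). -/
def rightAct (V : Submodule ℝ E) (x₀ : E) (u : E) (g : DualSpace V ≃ₗ[ℝ] DualSpace V) : E :=
  x₀ + (LinearMap.adjoint
    ((toV V).toLinearMap ∘ₗ g.toLinearMap ∘ₗ (toV V).symm.toLinearMap)
      (V.orthogonalProjectionOnto (u - x₀)) : V)

theorem rightAct_mem (V : Submodule ℝ E) (x₀ : E) (u : E)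
    (g : DualSpace V ≃ₗ[ℝ] DualSpace V) : rightAct V x₀ u g ∈ affineTranslate V x₀ := by
  unfold rightAct affineTranslate
  rw [Set.mem_ofPred_eq, add_sub_cancel_left]
  exact Subtype.property _

theorem pairing_rightAct (V : Submodule ℝ E) (x₀ : E) (w : DualSpace V) (u : E)
    (hu : u ∈ affineTranslate V x₀) (g : DualSpace V ≃ₗ[ℝ] DualSpace V) :
    pairing V x₀ (g w) u = pairing V x₀ w (rightAct V x₀ u g) := by
  have h1 : ((V.orthogonalProjectionOnto (u - x₀) : V) : E) = u - x₀ :=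
    Submodule.starProjection_eq_self_iff.2 hu
  unfold pairing rightAct
  rw [add_sub_cancel_left, ← Submodule.coe_inner, LinearMap.adjoint_inner_right]
  simp only [LinearMap.comp_apply, LinearEquiv.coe_coe, LinearEquiv.symm_apply_apply]
  rw [Submodule.coe_inner, h1]

/-- The symmetrization `𝔊(P)`, the convex hull of all `x g` with `x ∈ P` and `g ∈ 𝔊`. -/
def symmetrization (V : Submodule ℝ E) (x₀ : E)
    (𝔊 : Subgroup (DualSpace V ≃ₗ[ℝ] DualSpace V)) (P : Set E) : Set E :=
  convexHull ℝ {y | ∃ g ∈ 𝔊, ∃ x ∈ P, y = rightAct V x₀ x g}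

/-- `P` is `Φ`-placed: `P^∨` meets the relative interior of `Φ`. -/
def IsPlaced (V : Submodule ℝ E) (x₀ : E) (Φ : Set (DualSpace V)) (P : Set E) : Prop :=
  (perp V x₀ P ∩ intrinsicInterior ℝ Φ).Nonempty

/-- `P` is `Ψ`-appropriate: `P` lies in the relative interior of `Ψ`. -/
def IsAppropriate (Ψ P : Set E) : Prop := P ⊆ intrinsicInterior ℝ Ψ

/-- The fundamental fan `FFan(P)`: all faces of all intersections `σ ∩ Φ` with `σ ∈ Σ(P)`. -/
def fundamentalFan (V : Submodule ℝ E) (x₀ : E) (Φ : Set (DualSpace V)) (P : Set E) :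
    Set (Set (DualSpace V)) :=
  {τ | ∃ σ ∈ normalFan V x₀ P, τ ∈ coneFaces V (σ ∩ Φ)}

/-- `FFan(P, φ)`: the cones `τ` of `FFan(P)` such that `φ` is the inclusion-minimal face of `Φ`
that contains `τ`. -/
def refinedFan (V : Submodule ℝ E) (x₀ : E) (Φ : Set (DualSpace V)) (P : Set E)
    (φ : Set (DualSpace V)) : Set (Set (DualSpace V)) :=
  {τ ∈ fundamentalFan V x₀ Φ P | IsLeast {φ' ∈ coneFaces V Φ | τ ⊆ φ'} φ}

end Setting

end Symmetrization

end

/-! Everything rests on one fact about finite reflection groups: if `w` lies in the closed chamber,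
then `w - g w` is a nonnegative combination of positive roots for every `g` in the group. Points of
`P` are strictly positive on all positive roots, being in the relative interior of the dual chamber.
Hence `⟨g w, u⟩ ≤ ⟨w, u⟩` for `u ∈ P`, with equality only if `g w = w` (`form_apply_le`,
`apply_eq_of_form_eq`).

Every functional on `W` has the form `g w` with `w` in the chamber. By the inequality, the face of
the symmetrization maximal for `g w` is the hull of the points `x k` with `x` in the face of `P`
maximal for `w` and `k g` fixing `w` (`rightAct_mem_maximizers_iff`,
`mem_convexHull_of_mem_maximizers`). For fixed `g` it thus depends only on the maximal face of `P`
and on the stabilizer of `w`. The stabilizer carries the same information as the smallest face `φ`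
of the chamber containing `w`, so the two data together are exactly the cone `fanCone` of the
fundamental fan with `w` in its relative interior. Conversely, the face determines both `g w` and
this cone (`eq_of_maximizers_eq`).

So each cone of `FFan(P, φ)` yields one orbit of faces, of size `|𝔊| / |𝔊_φ|` by orbit-stabilizer,
and distinct cones yield disjoint orbits. The functionals constant on the face are the `g`-image of
the linear span of the cone (`mem_vectorSpan_fanCone_iff`), so the codimension of the cone is the
dimension of the face. Summing over cones and over `φ` gives the formula. -/

noncomputable section

namespace Symmetrization

/-! ### Root systems: simple roots, exchange property, dominance. -/

section Roots

variable {M : Type*} [AddCommGroup M] [Module ℝ M]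

/-- A finite reduced system of unit roots for a symmetric bilinear form `B`, with the reflections
`s α`, and a point `x` on none of the reflecting hyperplanes. -/
structure IsUnitRootSystem (B : LinearMap.BilinForm ℝ M) (s : M → M ≃ₗ[ℝ] M) (R : Set M)
    (x : M) : Prop where
  finite : R.Finite
  symm : ∀ u v, B u v = B v u
  unit : ∀ α ∈ R, B α α = 1
  neg : ∀ α ∈ R, -α ∈ R
  refl : ∀ α ∈ R, ∀ v, s α v = v - (2 * B α v) • α
  stable : ∀ α ∈ R, ∀ β ∈ R, s α β ∈ R
  regular : ∀ α ∈ R, B α x ≠ 0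

/-- The roots that are positive at `x`. -/
def positiveRoots (B : LinearMap.BilinForm ℝ M) (R : Set M) (x : M) : Set M :=
  {α ∈ R | 0 < B α x}

/-- The convex cone spanned by a set. -/
abbrev coneSpan (S : Set M) : Submodule NNReal M := Submodule.span NNReal S

theorem smul_mem_coneSpan {S : Set M} {c : ℝ} (hc : 0 ≤ c) {z : M} (hz : z ∈ coneSpan S) :
    c • z ∈ coneSpan S :=
  (coneSpan S).smul_mem (⟨c, hc⟩ : NNReal) hz

theorem form_nonneg_of_mem_coneSpan {B : LinearMap.BilinForm ℝ M} {S : Set M} {v z : M}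
    (h : ∀ α ∈ S, 0 ≤ B α v) (hz : z ∈ coneSpan S) : 0 ≤ B z v := by
  induction hz using Submodule.span_induction with
  | mem y hy => exact h y hy
  | zero => simp
  | add y z _ _ h1 h2 => simpa using add_nonneg h1 h2
  | smul c y _ h1 =>
    change 0 ≤ B ((c : ℝ) • y) v
    simpa using mul_nonneg c.2 h1

theorem eq_zero_or_form_pos_of_mem_coneSpan {B : LinearMap.BilinForm ℝ M} {S : Set M} {v z : M}
    (h : ∀ α ∈ S, 0 < B α v) (hz : z ∈ coneSpan S) : z = 0 ∨ 0 < B z v := by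
  induction hz using Submodule.span_induction with
  | mem y hy => exact Or.inr (h y hy)
  | zero => simp
  | add y z _ _ h1 h2 =>
    rcases h1 with rfl | h1
    · simpa using h2
    · rcases h2 with rfl | h2
      · simpa using Or.inr h1
      · right
        simpa using add_pos h1 h2
  | smul c y _ h1 =>
    rcases eq_or_ne c 0 with rfl | hc
    · simp
    · rcases h1 with rfl | h1
      · simp
      · right
        change 0 < B ((c : ℝ) • y) v
        have : (0 : ℝ) < c := NNReal.coe_pos.2 (pos_iff_ne_zero.2 hc)
        simpa using mul_pos this h1

variable {B : LinearMap.BilinForm ℝ M} {s : M → M ≃ₗ[ℝ] M} {R : Set M} {x : M}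

namespace IsUnitRootSystem

theorem positive_or_neg (h : IsUnitRootSystem B s R x) {α : M} (hα : α ∈ R) :
    α ∈ positiveRoots B R x ∨ -α ∈ positiveRoots B R x := by
  rcases lt_or_gt_of_ne (h.regular α hα) with h1 | h1
  · exact Or.inr ⟨h.neg α hα, by simpa using h1⟩
  · exact Or.inl ⟨hα, h1⟩

theorem refl_refl (h : IsUnitRootSystem B s R x) {α : M} (hα : α ∈ R) (v : M) :
    s α (s α v) = v := by
  rw [h.refl α hα (s α v), h.refl α hα v]
  simp only [map_sub, map_smul, h.unit α hα, smul_eq_mul]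
  module

theorem refl_mul_self (h : IsUnitRootSystem B s R x) {α : M} (hα : α ∈ R) : s α * s α = 1 :=
  LinearEquiv.ext fun v => h.refl_refl hα v

theorem refl_neg (h : IsUnitRootSystem B s R x) {α : M} (hα : α ∈ R) : s (-α) = s α := by
  ext v
  rw [h.refl _ (h.neg α hα), h.refl _ hα]
  simp

theorem form_refl (h : IsUnitRootSystem B s R x) {α : M} (hα : α ∈ R) (u v : M) :
    B (s α u) (s α v) = B u v := by
  rw [h.refl α hα, h.refl α hα]
  simp only [map_sub, map_smul, LinearMap.sub_apply, LinearMap.smul_apply, smul_eq_mul,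
    h.unit α hα, h.symm u α]
  ring

/-- The isometries that permute the roots. -/
def symmetries (B : LinearMap.BilinForm ℝ M) (R : Set M) : Submonoid (M ≃ₗ[ℝ] M) where
  carrier := {g | (∀ u v, B (g u) (g v) = B u v) ∧ ∀ α ∈ R, g α ∈ R}
  one_mem' := ⟨fun _ _ => rfl, fun _ h => h⟩
  mul_mem' := fun ha hb =>
    ⟨fun u v => (ha.1 _ _).trans (hb.1 u v), fun α hα => ha.2 _ (hb.2 α hα)⟩

theorem refl_mem_symmetries (h : IsUnitRootSystem B s R x) {α : M} (hα : α ∈ R) :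
    s α ∈ symmetries B R :=
  ⟨h.form_refl hα, h.stable α hα⟩

theorem mul_refl (h : IsUnitRootSystem B s R x) {g : M ≃ₗ[ℝ] M} (hg : g ∈ symmetries B R)
    {α : M} (hα : α ∈ R) : g * s α = s (g α) * g := by
  ext v
  simp only [LinearEquiv.mul_apply]
  rw [h.refl α hα, h.refl _ (hg.2 α hα), hg.1]
  simp

/-- A minimal set of positive roots whose cone contains all of them. -/
theorem exists_simple (h : IsUnitRootSystem B s R x) :
    ∃ S ⊆ positiveRoots B R x, positiveRoots B R x ⊆ coneSpan S ∧
      ∀ β ∈ S, β ∉ coneSpan (S \ {β}) := by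
  have hfin : (positiveRoots B R x).Finite := h.finite.subset fun _ h => h.1
  have hfin' : {S | S ⊆ positiveRoots B R x ∧
      positiveRoots B R x ⊆ (coneSpan S : Set M)}.Finite :=
    hfin.finite_subsets.subset fun _ h => h.1
  obtain ⟨S, hS⟩ := hfin'.exists_minimal ⟨_, Set.Subset.rfl, Submodule.subset_span⟩
  refine ⟨S, hS.prop.1, hS.prop.2, fun β hβ hmem => ?_⟩
  have h1 : coneSpan S ≤ coneSpan (S \ {β}) := by
    refine Submodule.span_le.2 fun γ hγ => ?_
    by_cases hγβ : γ = β
    · rw [hγβ]; exact hmem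
    · exact Submodule.subset_span ⟨hγ, hγβ⟩
  have h2 := hS.le_of_le (y := S \ {β})
    ⟨Set.sdiff_subset.trans hS.prop.1, hS.prop.2.trans h1⟩ Set.sdiff_subset
  exact (h2 hβ).2 rfl

variable {S : Set M}

/-- If `s β α` were negative, adding the expansions of `α` and `-s β α` over the simple roots would
give `k • β = z + z'` with `z`, `z'` in the cone of the other simple roots. For `k > 0` this
contradicts minimality of `S`. For `k ≤ 0`, evaluation at `x` forces `z = 0`, so `α` is a positive
multiple of `β`, and both are unit vectors. -/
theorem refl_simple_mem (h : IsUnitRootSystem B s R x) (hS : S ⊆ positiveRoots B R x)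
    (hspan : positiveRoots B R x ⊆ coneSpan S) (hmin : ∀ β ∈ S, β ∉ coneSpan (S \ {β}))
    {β : M} (hβ : β ∈ S) {α : M} (hα : α ∈ positiveRoots B R x) (hne : α ≠ β) :
    s β α ∈ positiveRoots B R x := by
  have hβR := (hS hβ).1
  rcases h.positive_or_neg (h.stable β hβR α hα.1) with h1 | h1
  · exact h1
  exfalso
  have hins : insert β (S \ {β}) = S := by
    rw [Set.insert_sdiff_singleton, Set.insert_eq_of_mem hβ]
  have hdec : ∀ γ ∈ positiveRoots B R x, ∃ c : NNReal, ∃ z ∈ coneSpan (S \ {β}),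
      γ = c • β + z := by
    intro γ hγ
    have := hspan hγ
    rw [← hins] at this
    exact Submodule.mem_span_insert.1 this
  obtain ⟨c, z, hz, hc⟩ := hdec α hα
  obtain ⟨d, z', hz', hd⟩ := hdec _ h1
  have hc' : α = (c : ℝ) • β + z := hc
  have hd' : -(s β α) = (d : ℝ) • β + z' := hd
  have hpos : ∀ γ ∈ S \ {β}, 0 < B γ x := fun γ hγ => (hS hγ.1).2
  have hsum : (2 * B β α - c - d) • β = z + z' := by
    rw [h.refl β hβR] at hd'
    have hz2 : z = α - (c : ℝ) • β := by rw [eq_sub_iff_add_eq, add_comm]; exact hc'.symm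
    have hz3 : z' = -(α - (2 * B β α) • β) - (d : ℝ) • β := by
      rw [eq_sub_iff_add_eq, add_comm]; exact hd'.symm
    rw [hz2, hz3]
    module
  rcases lt_or_ge 0 (2 * B β α - c - d) with hk | hk
  · refine hmin β hβ ?_
    have : β = (2 * B β α - c - d)⁻¹ • (z + z') := by
      rw [← hsum, smul_smul, inv_mul_cancel₀ hk.ne', one_smul]
    have hmem : (2 * B β α - c - d)⁻¹ • (z + z') ∈ coneSpan (S \ {β}) :=
      smul_mem_coneSpan (inv_nonneg.2 hk.le) (Submodule.add_mem _ hz hz')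
    rwa [← this] at hmem
  · have h2 : B z x + B z' x ≤ 0 := by
      have := congrArg (fun v => B v x) hsum
      simp only [map_add, map_smul, LinearMap.add_apply, LinearMap.smul_apply,
        smul_eq_mul] at this
      rw [← this]
      exact mul_nonpos_of_nonpos_of_nonneg hk (hS hβ).2.le
    have h3 := form_nonneg_of_mem_coneSpan (fun γ hγ => (hpos γ hγ).le) hz'
    rcases eq_zero_or_form_pos_of_mem_coneSpan hpos hz with hz0 | h4
    · rw [hz0, add_zero] at hc'
      have hu := h.unit α hα.1
      have hp := hα.2
      rw [hc'] at hu hp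
      simp only [map_smul, LinearMap.smul_apply, smul_eq_mul, h.unit β hβR] at hu hp
      have hc1 : (c : ℝ) = 1 := by
        have := c.2
        nlinarith [sq_nonneg ((c : ℝ) - 1), (show (0 : ℝ) ≤ c from c.2)]
      rw [hc1, one_smul] at hc'
      exact hne hc'
    · linarith

/-- Descent on the height `B α x`. Since `B α α > 0`, some simple `γ` has `B γ α > 0`; then `s γ α`
is a lower positive root unless `α = γ`, and `s α` is the conjugate of its reflection by `s γ`. -/
theorem simple_closure_eq (h : IsUnitRootSystem B s R x) (hS : S ⊆ positiveRoots B R x)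
    (hspan : positiveRoots B R x ⊆ coneSpan S) (hmin : ∀ β ∈ S, β ∉ coneSpan (S \ {β})) :
    ∀ α ∈ R, s α ∈ Submonoid.closure (s '' S) := by
  have hpos : ∀ α ∈ positiveRoots B R x, s α ∈ Submonoid.closure (s '' S) := by
    have hfin : (positiveRoots B R x).Finite := h.finite.subset fun _ h => h.1
    by_contra hcon
    push Not at hcon
    obtain ⟨α, ⟨hα, hαn⟩, hmin'⟩ := (hfin.subset (t := {α ∈ positiveRoots B R x |
      s α ∉ Submonoid.closure (s '' S)}) fun _ h => h.1).exists_minimalFor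
      (fun α => B α x) _ hcon
    have h1 : ∃ γ ∈ S, 0 < B γ α := by
      by_contra hc
      push Not at hc
      have h2 := form_nonneg_of_mem_coneSpan (B := B) (v := -α) (z := α) (S := S)
        (fun γ hγ => by simpa using hc γ hγ) (hspan hα)
      simp only [map_neg, h.unit α hα.1] at h2
      linarith
    obtain ⟨γ, hγ, hγα⟩ := h1
    have hγR := (hS hγ).1
    by_cases hne : α = γ
    · exact hαn (Submonoid.subset_closure ⟨γ, hγ, by rw [hne]⟩)
    have h3 := h.refl_simple_mem hS hspan hmin hγ hα hne
    have h4 : s (s γ α) ∉ Submonoid.closure (s '' S) := by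
      intro h5
      apply hαn
      have h6 := h.mul_refl (h.refl_mem_symmetries hγR) (h.stable γ hγR α hα.1)
      rw [h.refl_refl hγR] at h6
      have h7 : s α = s γ * s (s γ α) * s γ := by
        rw [h6, mul_assoc, h.refl_mul_self hγR, mul_one]
      have h8 : s γ ∈ Submonoid.closure (s '' S) := Submonoid.subset_closure ⟨γ, hγ, rfl⟩
      rw [h7]
      exact mul_mem (mul_mem h8 h5) h8
    have h9 : B (s γ α) x < B α x := by
      rw [h.refl γ hγR]
      simp only [map_sub, map_smul, LinearMap.sub_apply, LinearMap.smul_apply, smul_eq_mul]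
      have := mul_pos hγα (hS hγ).2
      linarith
    have := hmin' ⟨h3, h4⟩ h9.le
    linarith
  intro α hα
  rcases h.positive_or_neg hα with h1 | h1
  · exact hpos α h1
  · rw [← h.refl_neg hα]
    exact hpos _ h1

theorem prod_mem_symmetries (h : IsUnitRootSystem B s R x) (hS : S ⊆ positiveRoots B R x)
    {L : List M} (hL : ∀ β ∈ L, β ∈ S) : (L.map s).prod ∈ symmetries B R := by
  refine Submonoid.list_prod_mem _ fun g hg => ?_
  obtain ⟨β, hβ, rfl⟩ := List.mem_map.1 hg
  exact h.refl_mem_symmetries (hS (hL β hβ)).1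

/-- The exchange property of words in simple reflections. -/
theorem exists_shorter (h : IsUnitRootSystem B s R x) (hS : S ⊆ positiveRoots B R x)
    (hspan : positiveRoots B R x ⊆ coneSpan S) (hmin : ∀ β ∈ S, β ∉ coneSpan (S \ {β}))
    {β : M} (hβ : β ∈ S) (L : List M) (hL : ∀ γ ∈ L, γ ∈ S)
    (hneg : (L.map s).prod β ∉ positiveRoots B R x) :
    ∃ L' : List M, (∀ γ ∈ L', γ ∈ S) ∧ L'.length < L.length ∧
      (L.map s).prod * s β = (L'.map s).prod := by
  induction L with
  | nil => exact absurd (hS hβ) (by simpa using hneg)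
  | cons γ L ih =>
    have hγ : γ ∈ S := hL γ (by simp)
    have hL1 : ∀ δ ∈ L, δ ∈ S := fun δ hδ => hL δ (by simp [hδ])
    by_cases h1 : (L.map s).prod β ∈ positiveRoots B R x
    -- The sign changes exactly at the letter `γ`, and `s γ` makes no positive root negative except
    -- `γ`. Moving `s β` through the word then turns it into `s γ`, which cancels the first letter.
    · have h2 : (L.map s).prod β = γ := by
        by_contra hne
        apply hneg
        simpa using h.refl_simple_mem hS hspan hmin hγ h1 hne
      refine ⟨L, hL1, by simp, ?_⟩
      have h3 := h.mul_refl (h.prod_mem_symmetries hS hL1) (hS hβ).1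
      rw [h2] at h3
      rw [List.map_cons, List.prod_cons, mul_assoc, h3, ← mul_assoc,
        h.refl_mul_self (hS hγ).1, one_mul]
    · obtain ⟨L', h2, h3, h4⟩ := ih hL1 h1
      refine ⟨γ :: L', ?_, by simpa using h3, ?_⟩
      · intro δ hδ
        rcases List.mem_cons.1 hδ with rfl | hδ
        exacts [hγ, h2 δ hδ]
      · rw [List.map_cons, List.prod_cons, mul_assoc, h4, List.map_cons, List.prod_cons]

/-- A dominant point differs from every point of its orbit by a combination of positive roots. -/
theorem sub_mem_coneSpan (h : IsUnitRootSystem B s R x) {g : M ≃ₗ[ℝ] M}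
    (hg : g ∈ Subgroup.closure (s '' R)) {w : M}
    (hw : ∀ α ∈ positiveRoots B R x, 0 ≤ B α w) : w - g w ∈ coneSpan (positiveRoots B R x) := by
  obtain ⟨S, hS, hspan, hmin⟩ := h.exists_simple
  -- Induction on word length. A last letter `β` sent to a positive root by the preceding word adds
  -- a nonnegative multiple of that root; otherwise the exchange property shortens the word.
  have hwords : ∀ n : ℕ, ∀ L : List M, L.length = n → (∀ γ ∈ L, γ ∈ S) →
      w - (L.map s).prod w ∈ coneSpan (positiveRoots B R x) := by
    intro n
    induction n using Nat.strong_induction_on with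
    | _ n ih =>
      intro L hn hL
      rcases L.eq_nil_or_concat with rfl | ⟨L, β, rfl⟩
      · simp
      have hβ : β ∈ S := hL β (by simp)
      have hL1 : ∀ δ ∈ L, δ ∈ S := fun δ hδ => hL δ (by simp [hδ])
      have hn1 : L.length < n := by
        rw [← hn]; simp
      have hprod : ((L ++ [β]).map s).prod = (L.map s).prod * s β := by simp
      by_cases h1 : (L.map s).prod β ∈ positiveRoots B R x
      · have h2 : w - ((L ++ [β]).map s).prod w
            = (w - (L.map s).prod w) + (2 * B β w) • (L.map s).prod β := by
          rw [hprod, LinearEquiv.mul_apply, h.refl β (hS hβ).1, map_sub, map_smul]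
          module
        rw [List.concat_eq_append, h2]
        refine Submodule.add_mem _ (ih _ hn1 L rfl hL1)
          (smul_mem_coneSpan ?_ (Submodule.subset_span h1))
        have := hw β (hS hβ)
        positivity
      · obtain ⟨L', h2, h3, h4⟩ := h.exists_shorter hS hspan hmin hβ L hL1 h1
        rw [List.concat_eq_append, hprod, h4]
        exact ih _ (h3.trans hn1) L' rfl h2
  have hle : Submonoid.closure (s '' R) ≤ Submonoid.closure (s '' S) := by
    rw [Submonoid.closure_le]
    rintro _ ⟨α, hα, rfl⟩
    exact h.simple_closure_eq hS hspan hmin α hα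
  have hg' : g ∈ Submonoid.closure (s '' S) := by
    apply hle
    rw [← Subgroup.mem_toSubmonoid, Subgroup.closure_toSubmonoid] at hg
    refine Submonoid.closure_mono ?_ hg
    rintro k (hk | hk)
    · exact hk
    · obtain ⟨α, hα, hk⟩ := hk
      refine ⟨α, hα, ?_⟩
      have h1 := h.refl_mul_self hα
      rw [hk] at h1 ⊢
      rw [inv_eq_iff_mul_eq_one]
      simpa [mul_assoc] using (congrArg (fun a => k * k * a) h1).symm
  obtain ⟨l, hl, rfl⟩ := Submonoid.exists_list_of_mem_closure hg'
  choose! f hf1 hf2 using hl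
  have h3 : (l.map f).map s = l := by
    rw [List.map_map]
    conv_rhs => rw [← List.map_id l]
    exact List.map_congr_left fun a ha => hf2 a ha
  have h4 := hwords _ (l.map f) rfl (by
    intro γ hγ
    obtain ⟨a, ha, rfl⟩ := List.mem_map.1 hγ
    exact hf1 a ha)
  rwa [h3] at h4

end IsUnitRootSystem

end Roots

/-! ### From the hyperplane arrangement to its unit normals. -/

section Arrangement

variable {E : Type*} [NormedAddCommGroup E] [InnerProductSpace ℝ E] [FiniteDimensional ℝ E]

/-- The inner product of `W`, transported from `V`. -/
def dualForm (V : Submodule ℝ E) : LinearMap.BilinForm ℝ (DualSpace V) :=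
  (innerₗ V).compl₁₂ (toV V).toLinearMap (toV V).toLinearMap

theorem dualForm_apply (V : Submodule ℝ E) (u v : DualSpace V) :
    dualForm V u v = inner ℝ (toV V u) (toV V v) := rfl

theorem dualForm_comm (V : Submodule ℝ E) (u v : DualSpace V) :
    dualForm V u v = dualForm V v u := real_inner_comm _ _

theorem dualForm_self_pos (V : Submodule ℝ E) {u : DualSpace V} (hu : u ≠ 0) :
    0 < dualForm V u u := by
  rw [dualForm_apply]
  exact real_inner_self_pos.2 (by simpa using hu)

theorem toV_mk (V : Submodule ℝ E) {v : E} (hv : v ∈ V) :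
    toV V (Submodule.Quotient.mk v) = ⟨v, hv⟩ := by
  rw [← LinearEquiv.eq_symm_apply]
  exact (Submodule.quotientEquivOfIsCompl_symm_apply _ _ _ (⟨v, hv⟩ : V)).symm

theorem pairing_eq_dualForm {V : Submodule ℝ E} {x₀ : E} (hx₀ : x₀ ∈ Vᗮ) (w : DualSpace V)
    {u : E} (hu : u ∈ affineTranslate V x₀) :
    pairing V x₀ w u = dualForm V w (Submodule.Quotient.mk u) := by
  have h1 : (Submodule.Quotient.mk u : DualSpace V) = Submodule.Quotient.mk (u - x₀) := by
    rw [Submodule.Quotient.eq]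
    simpa using hx₀
  rw [h1, dualForm_apply, toV_mk V hu]
  rfl

theorem exists_dualForm_eq (V : Submodule ℝ E) (l : DualSpace V →ₗ[ℝ] ℝ) :
    ∃ a, l = dualForm V a := by
  let f : V →ₗ[ℝ] ℝ := l ∘ₗ (toV V).symm.toLinearMap
  refine ⟨(toV V).symm ((InnerProductSpace.toDual ℝ V).symm (LinearMap.toContinuousLinearMap f)),
    ?_⟩
  refine LinearMap.ext fun w => ?_
  rw [dualForm_apply, LinearEquiv.apply_symm_apply, InnerProductSpace.toDual_symm_apply]
  simp [f]

theorem exists_unit_smul (V : Submodule ℝ E) {a : DualSpace V} (ha : a ≠ 0) :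
    ∃ α : DualSpace V, ∃ c : ℝ, 0 < c ∧ dualForm V α α = 1 ∧ a = c • α := by
  have hp := dualForm_self_pos V ha
  have hs := Real.sqrt_pos.2 hp
  refine ⟨(√(dualForm V a a))⁻¹ • a, √(dualForm V a a), hs, ?_, ?_⟩
  · simp only [map_smul, LinearMap.smul_apply, smul_eq_mul]
    have := Real.mul_self_sqrt hp.le
    field_simp
    nlinarith
  · rw [smul_smul, mul_inv_cancel₀ hs.ne', one_smul]

theorem ker_smul_dualForm (V : Submodule ℝ E) (α : DualSpace V) {c : ℝ} (hc : c ≠ 0) :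
    LinearMap.ker (dualForm V (c • α)) = LinearMap.ker (dualForm V α) := by
  rw [map_smul, LinearMap.ker_smul _ _ hc]

theorem exists_unit_normal (V : Submodule ℝ E) {H : Submodule ℝ (DualSpace V)}
    (hH : IsCoatom H) :
    ∃ α, dualForm V α α = 1 ∧ H = LinearMap.ker (dualForm V α) := by
  obtain ⟨v, hv⟩ : ∃ v, v ∉ H := by
    by_contra! hc
    exact hH.1 (Submodule.eq_top_iff'.2 hc)
  obtain ⟨f, hf, hfH⟩ := Submodule.exists_dual_map_eq_bot_of_notMem hv inferInstance
  have h1 : H ≤ LinearMap.ker f := LinearMap.le_ker_iff_map.2 hfH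
  have h2 : H = LinearMap.ker f := by
    by_contra hne
    have := hH.2 _ (lt_of_le_of_ne h1 hne)
    exact hf (this.ge (Submodule.mem_top (x := v)))
  obtain ⟨a, ha⟩ := exists_dualForm_eq V f
  have ha0 : a ≠ 0 := by
    rintro rfl
    simp [ha] at hf
  obtain ⟨α, c, hc, hα, rfl⟩ := exists_unit_smul V ha0
  exact ⟨α, hα, by rw [h2, ha, ker_smul_dualForm V α hc.ne']⟩

theorem isCoatom_ker_dualForm (V : Submodule ℝ E) {α : DualSpace V}
    (hα : dualForm V α α = 1) : IsCoatom (LinearMap.ker (dualForm V α)) := by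
  apply LinearMap.isCoatom_ker_of_surjective
  apply LinearMap.surjective
  intro h0
  simp [h0] at hα

/-- The reflection of `W` in the hyperplane orthogonal to `α`. -/
def rootReflection (V : Submodule ℝ E) (α : DualSpace V) : DualSpace V ≃ₗ[ℝ] DualSpace V :=
  reflectionIn V (LinearMap.ker (dualForm V α))

theorem rootReflection_apply (V : Submodule ℝ E) {α : DualSpace V} (hα : dualForm V α α = 1)
    (v : DualSpace V) : rootReflection V α v = v - (2 * dualForm V α v) • α := by
  have h1 : (LinearMap.ker (dualForm V α)).map (toV V).toLinearMap = (ℝ ∙ toV V α)ᗮ := by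
    ext u
    rw [Submodule.mem_orthogonal_singleton_iff_inner_right]
    constructor
    · rintro ⟨w, hw, rfl⟩
      exact hw
    · intro hu
      refine ⟨(toV V).symm u, ?_, by simp⟩
      change dualForm V α _ = 0
      rw [dualForm_apply, LinearEquiv.apply_symm_apply, hu]
  have h2 : ‖toV V α‖ = 1 := by
    rw [dualForm_apply, real_inner_self_eq_norm_sq] at hα
    exact (pow_eq_one_iff_of_nonneg (norm_nonneg _) two_ne_zero).1 hα
  unfold rootReflection reflectionIn
  simp only [LinearEquiv.trans_apply]
  rw [LinearEquiv.symm_apply_eq, map_sub, map_smul, dualForm_apply]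
  change ((LinearMap.ker (dualForm V α)).map (toV V).toLinearMap).reflection _ = _
  simp only [h1]
  rw [Submodule.reflection_orthogonal_apply, Submodule.reflection_singleton_apply, h2]
  simp only [RCLike.ofReal_one, one_pow, div_one]
  module

/-- The unit normals of the hyperplanes of an arrangement. -/
def unitNormals (V : Submodule ℝ E) (𝓗 : Set (Submodule ℝ (DualSpace V))) :
    Set (DualSpace V) :=
  {α | dualForm V α α = 1 ∧ LinearMap.ker (dualForm V α) ∈ 𝓗}

variable {V : Submodule ℝ E} {𝓗 : Set (Submodule ℝ (DualSpace V))}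

/-- A hyperplane has only two unit normals: for normals `α`, `β` of the same one, `β - B(α,β) α` is
orthogonal to both, hence to itself. -/
theorem unitNormals_finite (hfin : 𝓗.Finite) : (unitNormals V 𝓗).Finite := by
  have h1 : unitNormals V 𝓗 ⊆ ⋃ H ∈ 𝓗, {α | dualForm V α α = 1 ∧
      LinearMap.ker (dualForm V α) = H} := by
    intro α hα
    simp only [Set.mem_iUnion]
    exact ⟨_, hα.2, hα.1, rfl⟩
  refine (hfin.biUnion fun H _ => ?_).subset h1
  rcases Set.eq_empty_or_nonempty {α | dualForm V α α = 1 ∧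
    LinearMap.ker (dualForm V α) = H} with h2 | ⟨α, hα⟩
  · rw [h2]; exact Set.finite_empty
  refine (Set.toFinite {α, -α}).subset ?_
  rintro β ⟨hβ1, hβ2⟩
  obtain ⟨hα1, hα2⟩ := hα
  have h3 : β - (dualForm V α β) • α ∈ LinearMap.ker (dualForm V β) := by
    rw [hβ2, ← hα2, LinearMap.mem_ker, map_sub, map_smul, hα1]
    simp
  have h5 : dualForm V α β * dualForm V α β = 1 := by
    rw [LinearMap.mem_ker, map_sub, map_smul, hβ1, dualForm_comm V β α, smul_eq_mul] at h3
    linarith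
  have h4 : β - (dualForm V α β) • α = 0 := by
    by_contra hne
    have := dualForm_self_pos V hne
    simp only [map_sub, map_smul, LinearMap.sub_apply, LinearMap.smul_apply, smul_eq_mul, hβ1,
      hα1, dualForm_comm V β α] at this
    linarith
  rw [sub_eq_zero] at h4
  rcases mul_self_eq_one_iff.1 h5 with h6 | h6
  · left; rw [h4, h6, one_smul]
  · right
    rw [Set.mem_singleton_iff, h4, h6, neg_smul, one_smul]

theorem rootReflection_mem {α : DualSpace V} (hα : α ∈ unitNormals V 𝓗) :
    rootReflection V α ∈ reflectionGroup V 𝓗 :=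
  Subgroup.subset_closure ⟨_, hα.2, rfl⟩

theorem closure_rootReflections (h𝓗 : ∀ H ∈ 𝓗, IsCoatom H) :
    Subgroup.closure (rootReflection V '' unitNormals V 𝓗) = reflectionGroup V 𝓗 := by
  unfold reflectionGroup
  congr 1
  ext g
  constructor
  · rintro ⟨α, hα, rfl⟩
    exact ⟨_, hα.2, rfl⟩
  · rintro ⟨H, hH, rfl⟩
    obtain ⟨α, hα, rfl⟩ := exists_unit_normal V (h𝓗 H hH)
    exact ⟨α, ⟨hα, hH⟩, rfl⟩

/-- The reflection in the reflected root is a conjugate of the reflection in `β`, so it lies in the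
group, and `determined` puts its hyperplane in `𝓗`. -/
theorem rootReflection_mem_unitNormals (h𝓗 : IsReflectionArrangement V 𝓗) {α β : DualSpace V}
    (hα : α ∈ unitNormals V 𝓗) (hβ : β ∈ unitNormals V 𝓗) :
    rootReflection V α β ∈ unitNormals V 𝓗 := by
  have hform : ∀ u v, dualForm V (rootReflection V α u) (rootReflection V α v)
      = dualForm V u v := by
    intro u v
    rw [rootReflection_apply V hα.1, rootReflection_apply V hα.1]
    simp only [map_sub, map_smul, LinearMap.sub_apply, LinearMap.smul_apply, smul_eq_mul, hα.1,
      dualForm_comm V u α]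
    ring
  have hunit : dualForm V (rootReflection V α β) (rootReflection V α β) = 1 := by
    rw [hform, hβ.1]
  refine ⟨hunit, h𝓗.determined _ (isCoatom_ker_dualForm V hunit) ?_⟩
  have h1 : rootReflection V (rootReflection V α β)
      = rootReflection V α * rootReflection V β * (rootReflection V α)⁻¹ := by
    rw [eq_mul_inv_iff_mul_eq]
    ext v
    rw [LinearEquiv.mul_apply, LinearEquiv.mul_apply, rootReflection_apply V hunit, hform,
      rootReflection_apply V hβ.1, map_sub, map_smul]
  change rootReflection V (rootReflection V α β) ∈ _
  rw [h1]
  exact mul_mem (mul_mem (rootReflection_mem hα) (rootReflection_mem hβ))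
    (inv_mem (rootReflection_mem hα))

/-- The point `w₀` defining the chamber is regular: if it lay on a hyperplane of `𝓗`, so would the
whole cone, against full dimension. Every functional testing membership is then a positive multiple
of a root, and that root is positive at `w₀`. -/
theorem IsChamber.exists_roots (h𝓗 : IsReflectionArrangement V 𝓗) {Φ : Set (DualSpace V)}
    (hΦ : IsChamber V 𝓗 Φ) :
    ∃ w₀, IsUnitRootSystem (dualForm V) (rootReflection V) (unitNormals V 𝓗) w₀ ∧
      Φ = {w | ∀ α ∈ positiveRoots (dualForm V) (unitNormals V 𝓗) w₀, 0 ≤ dualForm V α w} := by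
  obtain ⟨⟨w₀, rfl⟩, hdim⟩ := hΦ
  have hreg : ∀ α ∈ unitNormals V 𝓗, dualForm V α w₀ ≠ 0 := by
    intro α hα h0
    have hle : vectorSpan ℝ (arrangementCone V 𝓗 w₀) ≤ LinearMap.ker (dualForm V α) := by
      have hker : ∀ w ∈ arrangementCone V 𝓗 w₀, dualForm V α w = 0 := by
        intro w hw
        have h1 := hw (dualForm V α) hα.2 h0.ge
        have h2 := hw (-dualForm V α) (by rw [LinearMap.ker_neg]; exact hα.2) (by simp [h0])
        simp only [LinearMap.neg_apply] at h2
        linarith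
      rw [vectorSpan_def, Submodule.span_le]
      rintro _ ⟨u, hu, v, hv, rfl⟩
      simp [hker u hu, hker v hv]
    have h3 := Submodule.finrank_mono hle
    have h4 := Submodule.finrank_lt (isCoatom_ker_dualForm V hα.1).1
    unfold dim at hdim
    omega
  refine ⟨w₀, ⟨unitNormals_finite h𝓗.finite, dualForm_comm V, fun α hα => hα.1, fun α hα => ?_,
    fun α hα => rootReflection_apply V hα.1, fun α hα β hβ =>
      rootReflection_mem_unitNormals h𝓗 hα hβ, hreg⟩, ?_⟩
  · refine ⟨by simpa using hα.1, ?_⟩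
    rw [map_neg, LinearMap.ker_neg]
    exact hα.2
  · ext w
    constructor
    · intro hw α hα
      exact hw _ hα.1.2 hα.2.le
    · intro hw l hl hl0
      obtain ⟨a, rfl⟩ := exists_dualForm_eq V l
      have ha : a ≠ 0 := by
        rintro rfl
        apply (h𝓗.hyperplane _ hl).1
        simp
      obtain ⟨α, c, hc, hα, rfl⟩ := exists_unit_smul V ha
      rw [ker_smul_dualForm V α hc.ne'] at hl
      simp only [map_smul, LinearMap.smul_apply, smul_eq_mul] at hl0 ⊢
      have h1 : 0 ≤ dualForm V α w₀ := nonneg_of_mul_nonneg_right hl0 hc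
      have h2 := hreg α ⟨hα, hl⟩
      exact mul_nonneg hc.le (hw α ⟨⟨hα, hl⟩, lt_of_le_of_ne h1 h2.symm⟩)

end Arrangement

/-! ### The closed chamber as a fundamental domain; faces and stabilizers. -/

section Dominant

open Filter Topology

variable {M : Type*} [AddCommGroup M] [Module ℝ M]

/-- The closed chamber of the points on which no positive root is negative. -/
def dominantCone (B : LinearMap.BilinForm ℝ M) (R : Set M) (x : M) : Set M :=
  {w | ∀ α ∈ positiveRoots B R x, 0 ≤ B α w}

/-- The smallest face of the closed chamber that contains `w`. -/
def dominantFace (B : LinearMap.BilinForm ℝ M) (R : Set M) (x w : M) : Set M :=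
  {v ∈ dominantCone B R x | ∀ α ∈ positiveRoots B R x, B α w = 0 → B α v = 0}

/-- Used for finitely many inequalities at once: a small move preserves the strict ones, so only
those tight at the starting point constrain the direction. -/
theorem eventually_nonneg_add_mul {a b : ℝ} (ha : 0 ≤ a) (hb : a = 0 → 0 ≤ b) :
    ∀ᶠ ε in 𝓝[>] (0 : ℝ), 0 ≤ a + ε * b := by
  rcases ha.eq_or_lt with h | h
  · filter_upwards [self_mem_nhdsWithin] with ε hε
    rw [← h, zero_add]
    exact mul_nonneg (le_of_lt hε) (hb h.symm)
  · have h1 : Tendsto (fun ε : ℝ => a + ε * b) (𝓝[>] 0) (𝓝 a) := by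
      refine tendsto_nhdsWithin_of_tendsto_nhds ?_
      have : Continuous fun ε : ℝ => a + ε * b := by fun_prop
      simpa using this.tendsto 0
    filter_upwards [h1.eventually (lt_mem_nhds h)] with ε hε using hε.le

variable {B : LinearMap.BilinForm ℝ M} {s : M → M ≃ₗ[ℝ] M} {R : Set M} {x : M}

theorem dominantFace_congr {w w' : M}
    (hw : ∀ α ∈ positiveRoots B R x, B α w = 0 ↔ B α w' = 0) :
    dominantFace B R x w = dominantFace B R x w' := by
  ext v
  constructor
  · exact fun hv => ⟨hv.1, fun α hα h0 => hv.2 α hα ((hw α hα).2 h0)⟩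
  · exact fun hv => ⟨hv.1, fun α hα h0 => hv.2 α hα ((hw α hα).1 h0)⟩

theorem self_mem_dominantFace {w : M} (hw : w ∈ dominantCone B R x) :
    w ∈ dominantFace B R x w := ⟨hw, fun _ _ h => h⟩

namespace IsUnitRootSystem

theorem eventually_mem_dominantCone (h : IsUnitRootSystem B s R x) {w u : M}
    (hw : w ∈ dominantCone B R x)
    (hu : ∀ α ∈ positiveRoots B R x, B α w = 0 → 0 ≤ B α u) :
    ∀ᶠ ε in 𝓝[>] (0 : ℝ), w + ε • u ∈ dominantCone B R x := by
  have hfin : (positiveRoots B R x).Finite := h.finite.subset fun _ h => h.1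
  have := (eventually_all_finite hfin).2 fun α hα =>
    eventually_nonneg_add_mul (hw α hα) (hu α hα)
  filter_upwards [this] with ε hε α hα
  simpa using hε α hα

theorem form_apply_le (h : IsUnitRootSystem B s R x) {g : M ≃ₗ[ℝ] M}
    (hg : g ∈ Subgroup.closure (s '' R)) {w y : M} (hw : w ∈ dominantCone B R x)
    (hy : ∀ α ∈ positiveRoots B R x, 0 < B α y) : B (g w) y ≤ B w y := by
  have := form_nonneg_of_mem_coneSpan (fun α hα => (hy α hα).le) (h.sub_mem_coneSpan hg hw)
  rw [map_sub, LinearMap.sub_apply] at this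
  linarith

theorem apply_eq_of_form_eq (h : IsUnitRootSystem B s R x) {g : M ≃ₗ[ℝ] M}
    (hg : g ∈ Subgroup.closure (s '' R)) {w y : M} (hw : w ∈ dominantCone B R x)
    (hy : ∀ α ∈ positiveRoots B R x, 0 < B α y) (heq : B (g w) y = B w y) : g w = w := by
  rcases eq_zero_or_form_pos_of_mem_coneSpan hy (h.sub_mem_coneSpan hg hw) with h1 | h1
  · exact (sub_eq_zero.1 h1).symm
  · rw [map_sub, LinearMap.sub_apply] at h1
    linarith

/-- The dominance inequality at `x`, for `g` at `w` and for `g⁻¹` at `g w`, gives equality. -/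
theorem apply_eq_of_mem_dominantCone (h : IsUnitRootSystem B s R x) {g : M ≃ₗ[ℝ] M}
    (hg : g ∈ Subgroup.closure (s '' R)) {w : M} (hw : w ∈ dominantCone B R x)
    (hgw : g w ∈ dominantCone B R x) : g w = w := by
  have hx : ∀ α ∈ positiveRoots B R x, 0 < B α x := fun α hα => hα.2
  refine h.apply_eq_of_form_eq hg hw hx (le_antisymm (h.form_apply_le hg hw hx) ?_)
  have h1 := h.form_apply_le (inv_mem hg) hgw hx
  have h2 : g⁻¹ (g w) = w := g.symm_apply_apply w
  rwa [h2] at h1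

theorem refl_apply_eq_iff (h : IsUnitRootSystem B s R x) {α : M} (hα : α ∈ R) (w : M) :
    s α w = w ↔ B α w = 0 := by
  rw [h.refl α hα]
  constructor
  · intro h1
    have h2 : (2 * B α w) • α = 0 := by simpa using h1
    have h3 := congrArg (B α) h2
    rw [map_smul, h.unit α hα] at h3
    simpa using h3
  · intro h1
    simp [h1]

/-- The point `w + ε (w - v)` is still dominant for small `ε > 0`. As `g` fixes `w`, dominance there
reverses the inequality for `v`, so equality holds at `v`. -/
theorem apply_eq_of_mem_dominantFace (h : IsUnitRootSystem B s R x) {g : M ≃ₗ[ℝ] M}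
    (hg : g ∈ Subgroup.closure (s '' R)) {w v : M} (hw : w ∈ dominantCone B R x)
    (hv : v ∈ dominantFace B R x w) (hgw : g w = w) : g v = v := by
  have hx : ∀ α ∈ positiveRoots B R x, 0 < B α x := fun α hα => hα.2
  obtain ⟨ε, hε, hε0⟩ := ((h.eventually_mem_dominantCone (u := w - v) hw fun α hα h0 => by
    rw [map_sub, h0, hv.2 α hα h0, sub_zero]).and self_mem_nhdsWithin).exists
  have hε1 : 0 < ε := hε0
  refine h.apply_eq_of_form_eq hg hv.1 hx (le_antisymm (h.form_apply_le hg hv.1 hx) ?_)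
  have h1 := h.form_apply_le hg hε hx
  simp only [map_add, map_smul, map_sub, hgw, LinearMap.add_apply, LinearMap.sub_apply,
    LinearMap.smul_apply, smul_eq_mul] at h1
  nlinarith

/-- The reflections in the stabilizer already record which roots vanish. -/
theorem dominantFace_eq_of_stabilizer (h : IsUnitRootSystem B s R x) {w w' : M}
    (hstab : ∀ g ∈ Subgroup.closure (s '' R), g w = w ↔ g w' = w') :
    dominantFace B R x w = dominantFace B R x w' := by
  refine dominantFace_congr fun α hα => ?_
  rw [← h.refl_apply_eq_iff hα.1, ← h.refl_apply_eq_iff hα.1]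
  exact hstab _ (Subgroup.subset_closure ⟨α, hα.1, rfl⟩)

theorem stabilizer_eq_of_dominantFace (h : IsUnitRootSystem B s R x) {w w' : M}
    (hw : w ∈ dominantCone B R x) (hw' : w' ∈ dominantCone B R x)
    (heq : dominantFace B R x w = dominantFace B R x w') {g : M ≃ₗ[ℝ] M}
    (hg : g ∈ Subgroup.closure (s '' R)) : g w = w ↔ g w' = w' :=
  ⟨h.apply_eq_of_mem_dominantFace hg hw (heq ▸ self_mem_dominantFace hw'),
    h.apply_eq_of_mem_dominantFace hg hw' (heq ▸ self_mem_dominantFace hw)⟩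

/-- Take `g` maximizing `B (g w) x`; a positive root negative on `g w` would allow a further
increase by its reflection. -/
theorem exists_apply_mem_dominantCone (h : IsUnitRootSystem B s R x)
    [hfin : Finite (Subgroup.closure (s '' R))] (w : M) :
    ∃ g ∈ Subgroup.closure (s '' R), g w ∈ dominantCone B R x := by
  obtain ⟨g, hg⟩ := Finite.exists_max fun g : Subgroup.closure (s '' R) => B (g.1 w) x
  refine ⟨g.1, g.2, fun α hα => ?_⟩
  by_contra! hneg
  have h1 := hg (⟨s α, Subgroup.subset_closure ⟨α, hα.1, rfl⟩⟩ * g)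
  have h2 : B ((s α * g.1) w) x = B (g.1 w) x - 2 * B α (g.1 w) * B α x := by
    rw [LinearEquiv.mul_apply, h.refl α hα.1]
    simp
  change B ((s α * g.1) w) x ≤ _ at h1
  rw [h2] at h1
  nlinarith [mul_neg_of_neg_of_pos hneg hα.2]

/-- The setwise stabilizer of a face of the closed chamber is the stabilizer of each point of its
relative interior. -/
theorem smul_dominantFace_eq_iff (h : IsUnitRootSystem B s R x) {w : M}
    (hw : w ∈ dominantCone B R x) {g : M ≃ₗ[ℝ] M} (hg : g ∈ Subgroup.closure (s '' R)) :
    g '' dominantFace B R x w = dominantFace B R x w ↔ g w = w := by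
  constructor
  · intro h1
    have h2 : g w ∈ dominantFace B R x w :=
      h1 ▸ Set.mem_image_of_mem g (self_mem_dominantFace hw)
    exact h.apply_eq_of_mem_dominantCone hg hw h2.1
  · intro h1
    have h2 : ∀ v ∈ dominantFace B R x w, g v = v := fun v hv =>
      h.apply_eq_of_mem_dominantFace hg hw hv h1
    rw [Set.image_congr h2, Set.image_id']

end IsUnitRootSystem

/-- From a point of the relative interior one can move a little away from any other point. -/
theorem exists_add_smul_sub_mem {F : Type*} [NormedAddCommGroup F] [NormedSpace ℝ F] {C : Set F}
    {u v : F} (hu : u ∈ intrinsicInterior ℝ C) (hv : v ∈ C) :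
    ∃ ε > (0 : ℝ), u + ε • (u - v) ∈ C := by
  obtain ⟨y, hy, rfl⟩ := mem_intrinsicInterior.1 hu
  have hmem : ∀ t : ℝ, (y : F) + t • ((y : F) - v) ∈ affineSpan ℝ C := by
    intro t
    have := AffineMap.lineMap_mem (-t) y.2 (subset_affineSpan ℝ C hv)
    rw [AffineMap.lineMap_apply, vsub_eq_sub, vadd_eq_add] at this
    convert this using 1
    module
  let f : ℝ → affineSpan ℝ C := fun t => ⟨(y : F) + t • ((y : F) - v), hmem t⟩
  have hf : Continuous f := by
    apply Continuous.subtype_mk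
    fun_prop
  have hf0 : f 0 = y := by
    apply Subtype.ext
    simp [f]
  have h1 : ∀ᶠ t in 𝓝 (0 : ℝ), f t ∈ interior (Subtype.val ⁻¹' C : Set (affineSpan ℝ C)) :=
    hf.continuousAt.eventually (isOpen_interior.mem_nhds (by rwa [hf0]))
  obtain ⟨ε, h2, h3⟩ := ((h1.filter_mono nhdsWithin_le_nhds).and
    (self_mem_nhdsWithin (s := Set.Ioi (0 : ℝ)))).exists
  exact ⟨ε, h3, interior_subset (s := (Subtype.val ⁻¹' C : Set (affineSpan ℝ C))) h2⟩

end Dominant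

/-! ### Cones of the fundamental fan, parametrized by relative interior points. -/

section FundamentalFan

open Filter Topology

variable {E : Type*} [NormedAddCommGroup E] [InnerProductSpace ℝ E] [FiniteDimensional ℝ E]

/-- The points of `S` at which `⟨w, ·⟩` is maximal. -/
def maximizers (V : Submodule ℝ E) (x₀ : E) (w : DualSpace V) (S : Set E) : Set E :=
  {x ∈ S | ∀ y ∈ S, pairing V x₀ w y ≤ pairing V x₀ w x}

variable {V : Submodule ℝ E} {x₀ : E}

theorem mem_faces_iff {P F : Set E} :
    F ∈ faces V x₀ P ↔ ∃ w, (maximizers V x₀ w P).Nonempty ∧ F = maximizers V x₀ w P := by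
  constructor
  · rintro ⟨h1, w, rfl⟩
    exact ⟨w, h1, rfl⟩
  · rintro ⟨w, h1, rfl⟩
    exact ⟨h1, w, rfl⟩

theorem pairing_add (v w : DualSpace V) (u : E) :
    pairing V x₀ (v + w) u = pairing V x₀ v u + pairing V x₀ w u := by
  simp [pairing, inner_add_left]

theorem pairing_smul (c : ℝ) (w : DualSpace V) (u : E) :
    pairing V x₀ (c • w) u = c * pairing V x₀ w u := by
  simp [pairing, real_inner_smul_left]

theorem pairing_sub (v w : DualSpace V) (u : E) :
    pairing V x₀ (v - w) u = pairing V x₀ v u - pairing V x₀ w u := by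
  simp [pairing, inner_sub_left]

theorem pairing_combo (w : DualSpace V) {a b : ℝ} (hab : a + b = 1) (u v : E) :
    pairing V x₀ w (a • u + b • v) = a * pairing V x₀ w u + b * pairing V x₀ w v := by
  have : a • u + b • v - x₀ = a • (u - x₀) + b • (v - x₀) := by
    have h1 : x₀ = (a + b) • x₀ := by rw [hab, one_smul]
    conv_lhs => rw [h1]
    module
  unfold pairing
  rw [this, inner_add_right, real_inner_smul_right, real_inner_smul_right]

theorem continuous_pairing (w : DualSpace V) : Continuous (pairing V x₀ w) := by
  unfold pairing
  fun_prop

theorem convex_pairing_le (w : DualSpace V) (c : ℝ) : Convex ℝ {u | pairing V x₀ w u ≤ c} := by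
  intro u hu v hv a b ha hb hab
  rw [Set.mem_ofPred_eq] at hu hv ⊢
  rw [pairing_combo w hab]
  calc _ ≤ a * c + b * c := by gcongr
    _ = c := by rw [← add_mul, hab, one_mul]

theorem convex_pairing_eq (w : DualSpace V) (c : ℝ) : Convex ℝ {u | pairing V x₀ w u = c} := by
  intro u hu v hv a b ha hb hab
  rw [Set.mem_ofPred_eq] at hu hv ⊢
  rw [pairing_combo w hab, hu, hv, ← add_mul, hab, one_mul]

omit [FiniteDimensional ℝ E] in
theorem convex_affineTranslate : Convex ℝ (affineTranslate V x₀) := by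
  intro u hu v hv a b ha hb hab
  have : a • u + b • v - x₀ = a • (u - x₀) + b • (v - x₀) := by
    have h1 : x₀ = (a + b) • x₀ := by rw [hab, one_smul]
    conv_lhs => rw [h1]
    module
  change _ ∈ V
  rw [this]
  exact V.add_mem (V.smul_mem _ hu) (V.smul_mem _ hv)

omit [FiniteDimensional ℝ E] in
theorem IsPolytope.subset {P : Set E} (hP : IsPolytope V x₀ P) : P ⊆ affineTranslate V x₀ := by
  obtain ⟨s, -, hs, rfl⟩ := hP
  exact convexHull_min hs convex_affineTranslate

theorem IsPolytope.maximizers_nonempty {P : Set E} (hP : IsPolytope V x₀ P) (hne : P.Nonempty)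
    (w : DualSpace V) : (maximizers V x₀ w P).Nonempty := by
  obtain ⟨s, hs, -, rfl⟩ := hP
  obtain ⟨x, hx, hmax⟩ := (hs.isCompact_convexHull ℝ).exists_isMaxOn hne
    (continuous_pairing (x₀ := x₀) w).continuousOn
  exact ⟨x, hx, hmax⟩

theorem mem_ncone_maximizers_iff {P : Set E} {w v : DualSpace V} :
    v ∈ ncone V x₀ (maximizers V x₀ w P) P ↔ maximizers V x₀ w P ⊆ maximizers V x₀ v P :=
  ⟨fun h x hx => ⟨hx.1, h x hx⟩, fun h _ hx => (h hx).2⟩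

/-- Only the finitely many generators of `P` need checking: one off the maximal face is strictly
below the maximum, and on that face `u` is constant. -/
theorem IsPolytope.eventually_mem_ncone {P : Set E} (hP : IsPolytope V x₀ P) (hne : P.Nonempty)
    {w u : DualSpace V}
    (hu : ∀ x ∈ maximizers V x₀ w P, ∀ y ∈ maximizers V x₀ w P,
      pairing V x₀ u x = pairing V x₀ u y) :
    ∀ᶠ ε in 𝓝[>] (0 : ℝ), w + ε • u ∈ ncone V x₀ (maximizers V x₀ w P) P := by
  obtain ⟨x, hx⟩ := hP.maximizers_nonempty hne w
  obtain ⟨s, hs, -, rfl⟩ := hP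
  have hev : ∀ y ∈ s, ∀ᶠ ε in 𝓝[>] (0 : ℝ),
      0 ≤ (pairing V x₀ w x - pairing V x₀ w y)
        + ε * (pairing V x₀ u x - pairing V x₀ u y) := by
    intro y hy
    have hyP := subset_convexHull ℝ s hy
    refine eventually_nonneg_add_mul (sub_nonneg.2 (hx.2 y hyP)) fun h0 => ?_
    rw [sub_eq_zero] at h0
    rw [hu x hx y ⟨hyP, fun z hz => h0 ▸ hx.2 z hz⟩, sub_self]
  filter_upwards [(eventually_all_finite hs).2 hev] with ε hε x' hx' y hy
  have h1 : pairing V x₀ (w + ε • u) x' = pairing V x₀ (w + ε • u) x := by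
    rw [pairing_add, pairing_add, pairing_smul, pairing_smul, hu x' hx' x hx,
      le_antisymm (hx.2 x' hx'.1) (hx'.2 x hx.1)]
  rw [h1]
  refine convexHull_min (fun y hy => ?_) (convex_pairing_le (w + ε • u) _) hy
  rw [Set.mem_ofPred_eq, pairing_add, pairing_add, pairing_smul, pairing_smul]
  have := hε y hy
  linarith

/-- The smallest cone of the fundamental fan that contains `w`. -/
def fanCone (V : Submodule ℝ E) (x₀ : E) (R : Set (DualSpace V)) (w₀ : DualSpace V) (P : Set E)
    (w : DualSpace V) : Set (DualSpace V) :=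
  ncone V x₀ (maximizers V x₀ w P) P ∩ dominantFace (dualForm V) R w₀ w

variable {s : DualSpace V → DualSpace V ≃ₗ[ℝ] DualSpace V} {R : Set (DualSpace V)}
  {w₀ : DualSpace V} {P : Set E}

theorem self_mem_fanCone {w : DualSpace V} (hw : w ∈ dominantCone (dualForm V) R w₀) :
    w ∈ fanCone V x₀ R w₀ P w :=
  ⟨mem_ncone_maximizers_iff.2 subset_rfl, self_mem_dominantFace hw⟩

theorem pairing_eq_of_mem_ncone {w v : DualSpace V}
    (hv : v ∈ ncone V x₀ (maximizers V x₀ w P) P) :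
    ∀ x ∈ maximizers V x₀ w P, ∀ y ∈ maximizers V x₀ w P,
      pairing V x₀ v x = pairing V x₀ v y :=
  fun x hx y hy => le_antisymm (hv y hy x hx.1) (hv x hx y hy.1)

theorem IsPolytope.eventually_mem_fanCone (hP : IsPolytope V x₀ P) (hne : P.Nonempty)
    (h : IsUnitRootSystem (dualForm V) s R w₀) {w u : DualSpace V}
    (hw : w ∈ dominantCone (dualForm V) R w₀)
    (hu : ∀ x ∈ maximizers V x₀ w P, ∀ y ∈ maximizers V x₀ w P,
      pairing V x₀ u x = pairing V x₀ u y)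
    (hu' : ∀ α ∈ positiveRoots (dualForm V) R w₀, dualForm V α w = 0 → dualForm V α u = 0) :
    ∀ᶠ ε in 𝓝[>] (0 : ℝ), w + ε • u ∈ fanCone V x₀ R w₀ P w := by
  filter_upwards [hP.eventually_mem_ncone hne hu,
    h.eventually_mem_dominantCone hw fun α hα h0 => (hu' α hα h0).ge] with ε h1 h2
  refine ⟨h1, h2, fun α hα h0 => ?_⟩
  simp [h0, hu' α hα h0]

theorem exists_relative_interior {C : Set (DualSpace V)} (hC : Convex ℝ C) (hne : C.Nonempty) :
    ∃ w ∈ C, ∀ v ∈ C, ∃ ε > (0 : ℝ), w + ε • (w - v) ∈ C := by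
  obtain ⟨y, hy⟩ := (hne.image (toV V)).intrinsicInterior
    (hC.linear_image (toV V).toLinearMap)
  obtain ⟨w, hw, rfl⟩ := intrinsicInterior_subset hy
  refine ⟨w, hw, fun v hv => ?_⟩
  obtain ⟨ε, hε, h1⟩ := exists_add_smul_sub_mem hy (Set.mem_image_of_mem _ hv)
  refine ⟨ε, hε, ?_⟩
  rw [← map_sub, ← map_smul, ← map_add] at h1
  exact (toV V).injective.mem_set_image.1 h1

omit [FiniteDimensional ℝ E] in
theorem convex_of_mem_coneFaces {K τ : Set (DualSpace V)} (hK : Convex ℝ K)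
    (hτ : τ ∈ coneFaces V K) : Convex ℝ τ := by
  obtain ⟨-, l, rfl⟩ := hτ
  intro u hu v hv a b ha hb hab
  refine ⟨hK hu.1 hv.1 ha hb hab, fun w hw => ?_⟩
  have h1 := hu.2 w hw
  have h2 := hv.2 w hw
  simp only [map_add, map_smul, smul_eq_mul]
  calc l w = a * l w + b * l w := by rw [← add_mul, hab, one_mul]
    _ ≤ _ := by gcongr

-- A functional maximal on `K` at `w` cannot be smaller at `v`, since it would then increase beyond
-- `w`.
omit [FiniteDimensional ℝ E] in
theorem mem_of_mem_coneFaces {K τ : Set (DualSpace V)} (hτ : τ ∈ coneFaces V K)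
    {w v : DualSpace V} (hw : w ∈ τ) (hv : v ∈ K) {ε : ℝ} (hε : 0 < ε)
    (hmem : w + ε • (w - v) ∈ K) : v ∈ τ := by
  obtain ⟨-, l, rfl⟩ := hτ
  refine ⟨hv, fun z hz => (hw.2 z hz).trans ?_⟩
  have h1 := hw.2 _ hmem
  simp only [map_add, map_smul, map_sub, smul_eq_mul] at h1
  nlinarith

omit [FiniteDimensional ℝ E] in
theorem subset_of_mem_coneFaces {K τ : Set (DualSpace V)} (hτ : τ ∈ coneFaces V K) : τ ⊆ K := by
  obtain ⟨-, l, rfl⟩ := hτ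
  exact fun _ h => h.1

theorem convex_dominantCone : Convex ℝ (dominantCone (dualForm V) R w₀) := by
  intro u hu v hv a b ha hb hab α hα
  have h1 := hu α hα
  have h2 := hv α hα
  simp only [map_add, map_smul, smul_eq_mul]
  positivity

theorem convex_ncone (F P : Set E) : Convex ℝ (ncone V x₀ F P) := by
  intro u hu v hv a b ha hb hab x hx y hy
  have h1 := hu x hx y hy
  have h2 := hv x hx y hy
  simp only [pairing_add, pairing_smul]
  gcongr

/-- A face cut out of a subset of the closed chamber by equations `B α v = 0`. -/
theorem inter_dominantFace_mem_coneFaces (h : IsUnitRootSystem (dualForm V) s R w₀)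
    {N : Set (DualSpace V)} {w : DualSpace V} (hwN : w ∈ N)
    (hw : w ∈ dominantCone (dualForm V) R w₀) :
    N ∩ dominantFace (dualForm V) R w₀ w
      ∈ coneFaces V (N ∩ dominantCone (dualForm V) R w₀) := by
  classical
  have hfin : {α ∈ positiveRoots (dualForm V) R w₀ | dualForm V α w = 0}.Finite :=
    h.finite.subset fun _ h => h.1.1
  -- Minus the sum of the positive roots vanishing at `w`: nonpositive on the chamber, and zero
  -- exactly where all of them vanish.
  let l : DualSpace V →ₗ[ℝ] ℝ := -∑ α ∈ hfin.toFinset, dualForm V α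
  have hl : ∀ v, l v = -∑ α ∈ hfin.toFinset, dualForm V α v := by
    intro v
    simp [l, LinearMap.sum_apply]
  have hlw : l w = 0 := by
    rw [hl, Finset.sum_eq_zero, neg_zero]
    intro α hα
    exact ((Set.Finite.mem_toFinset _).1 hα).2
  have hnn : ∀ v ∈ dominantCone (dualForm V) R w₀, ∀ α ∈ hfin.toFinset, 0 ≤ dualForm V α v :=
    fun v hv α hα => hv α ((Set.Finite.mem_toFinset _).1 hα).1
  have hle : ∀ v ∈ dominantCone (dualForm V) R w₀, l v ≤ 0 := by
    intro v hv
    rw [hl, neg_nonpos]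
    exact Finset.sum_nonneg (hnn v hv)
  refine ⟨⟨w, hwN, self_mem_dominantFace hw⟩, l, ?_⟩
  ext v
  constructor
  · rintro ⟨h1, h2, h3⟩
    refine ⟨⟨h1, h2⟩, fun z hz => (hle z hz.2).trans ?_⟩
    rw [hl, Finset.sum_eq_zero, neg_zero]
    intro α hα
    have := (Set.Finite.mem_toFinset _).1 hα
    exact h3 α this.1 this.2
  · rintro ⟨⟨h1, h2⟩, h3⟩
    refine ⟨h1, h2, fun α hα h0 => ?_⟩
    have h4 := h3 w ⟨hwN, hw⟩
    rw [hlw, hl] at h4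
    have h5 := Finset.sum_nonneg (hnn v h2)
    exact (Finset.sum_eq_zero_iff_of_nonneg (hnn v h2)).1 (by linarith) α
      ((Set.Finite.mem_toFinset _).2 ⟨hα, h0⟩)

theorem subset_dominantFace {τ : Set (DualSpace V)} {w : DualSpace V}
    (hτ : τ ⊆ dominantCone (dualForm V) R w₀)
    (hw : ∀ v ∈ τ, ∃ ε > (0 : ℝ), w + ε • (w - v) ∈ τ) :
    τ ⊆ dominantFace (dualForm V) R w₀ w := by
  intro v hv
  refine ⟨hτ hv, fun α hα h0 => ?_⟩
  obtain ⟨ε, hε, h1⟩ := hw v hv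
  have h2 := hτ h1 α hα
  have h3 := hτ hv α hα
  simp only [map_add, map_smul, map_sub, h0, smul_eq_mul] at h2
  nlinarith

theorem coneFaces_dominantCone (h : IsUnitRootSystem (dualForm V) s R w₀) :
    coneFaces V (dominantCone (dualForm V) R w₀)
      = dominantFace (dualForm V) R w₀ '' dominantCone (dualForm V) R w₀ := by
  ext τ
  constructor
  · intro hτ
    obtain ⟨w, hw, hrel⟩ :=
      exists_relative_interior (convex_of_mem_coneFaces convex_dominantCone hτ) hτ.1
    have hsub := subset_of_mem_coneFaces hτ
    refine ⟨w, hsub hw, Set.Subset.antisymm ?_ (subset_dominantFace hsub hrel)⟩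
    intro v hv
    obtain ⟨ε, hε, hε0⟩ := ((h.eventually_mem_dominantCone (u := w - v) (hsub hw)
      fun α hα h0 => by rw [map_sub, h0, hv.2 α hα h0, sub_zero]).and
        self_mem_nhdsWithin).exists
    exact mem_of_mem_coneFaces hτ hw hv.1 hε0 hε
  · rintro ⟨w, hw, rfl⟩
    simpa using inter_dominantFace_mem_coneFaces h (Set.mem_univ w) hw

/-- A face of `σ ∩ Φ` equals `fanCone` of any of its relative interior points `w`: from `w` one can
move slightly away from any point of either set without leaving that set. -/
theorem IsPolytope.fundamentalFan_eq (hP : IsPolytope V x₀ P) (hne : P.Nonempty)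
    (h : IsUnitRootSystem (dualForm V) s R w₀) :
    fundamentalFan V x₀ (dominantCone (dualForm V) R w₀) P
      = fanCone V x₀ R w₀ P '' dominantCone (dualForm V) R w₀ := by
  ext τ
  constructor
  · rintro ⟨σ, ⟨F, hF, rfl⟩, hτ⟩
    obtain ⟨w₁, ⟨x₁, hx₁⟩, rfl⟩ := mem_faces_iff.1 hF
    obtain ⟨w, hw, hrel⟩ := exists_relative_interior
      (convex_of_mem_coneFaces ((convex_ncone _ _).inter convex_dominantCone) hτ) hτ.1
    have hsub := subset_of_mem_coneFaces hτ
    have hwD := (hsub hw).2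
    refine ⟨w, hwD, Set.Subset.antisymm ?_ ?_⟩
    · intro v hv
      have hF1 : maximizers V x₀ w₁ P ⊆ maximizers V x₀ w P :=
        mem_ncone_maximizers_iff.1 (hsub hw).1
      have hle : ncone V x₀ (maximizers V x₀ w P) P
          ⊆ ncone V x₀ (maximizers V x₀ w₁ P) P := fun z hz =>
        mem_ncone_maximizers_iff.2 (hF1.trans (mem_ncone_maximizers_iff.1 hz))
      obtain ⟨ε, hε, hε0⟩ := ((hP.eventually_mem_fanCone hne h (u := w - v) hwD
        (fun x hx y hy => by
          rw [pairing_sub, pairing_sub, pairing_eq_of_mem_ncone hv.1 x hx y hy,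
            le_antisymm (hy.2 x hx.1) (hx.2 y hy.1)])
        (fun α hα h0 => by rw [map_sub, h0, hv.2.2 α hα h0, sub_zero])).and
          self_mem_nhdsWithin).exists
      exact mem_of_mem_coneFaces hτ hw ⟨hle hv.1, hv.2.1⟩ hε0 ⟨hle hε.1, hε.2.1⟩
    · intro v hv
      refine ⟨?_, subset_dominantFace (hsub.trans Set.inter_subset_right) hrel hv⟩
      -- Compare a maximizer `x` of `w` with `x₁`, which is maximal for all of `τ`. If `v` were
      -- smaller at `x`, then `w + ε (w - v)` would be larger at `x` than at `x₁`.
      obtain ⟨ε, hε, h1⟩ := hrel v hv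
      have hv1 := (hsub hv).1 x₁ hx₁
      have h2 := (hsub h1).1 x₁ hx₁
      intro x hx y hy
      refine (hv1 y hy).trans ?_
      have h3 := h2 x hx.1
      have h4 := hv1 x hx.1
      have h5 := hx.2 x₁ hx₁.1
      simp only [pairing_add, pairing_smul, pairing_sub] at h3
      nlinarith
  · rintro ⟨w, hw, rfl⟩
    refine ⟨_, ⟨_, mem_faces_iff.2 ⟨w, hP.maximizers_nonempty hne w, rfl⟩, rfl⟩, ?_⟩
    exact inter_dominantFace_mem_coneFaces h (mem_ncone_maximizers_iff.2 subset_rfl) hw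

theorem isLeast_dominantFace (h : IsUnitRootSystem (dualForm V) s R w₀) {w : DualSpace V}
    (hw : w ∈ dominantCone (dualForm V) R w₀) :
    IsLeast {φ ∈ coneFaces V (dominantCone (dualForm V) R w₀) | fanCone V x₀ R w₀ P w ⊆ φ}
      (dominantFace (dualForm V) R w₀ w) := by
  refine ⟨⟨?_, Set.inter_subset_right⟩, ?_⟩
  · rw [coneFaces_dominantCone h]
    exact Set.mem_image_of_mem _ hw
  · rintro φ ⟨hφ, hsub⟩ v hv
    obtain ⟨ε, hε, hε0⟩ := ((h.eventually_mem_dominantCone (u := w - v) hw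
      fun α hα h0 => by rw [map_sub, h0, hv.2 α hα h0, sub_zero]).and
        self_mem_nhdsWithin).exists
    exact mem_of_mem_coneFaces hφ (hsub (self_mem_fanCone hw)) hv.1 hε0 hε

/-- If the cones agree, each point lies in the cone of the other, which gives both inclusions for
each datum. -/
theorem fanCone_eq_iff {w w' : DualSpace V} (hw : w ∈ dominantCone (dualForm V) R w₀)
    (hw' : w' ∈ dominantCone (dualForm V) R w₀) :
    fanCone V x₀ R w₀ P w = fanCone V x₀ R w₀ P w' ↔
      maximizers V x₀ w P = maximizers V x₀ w' P ∧
        dominantFace (dualForm V) R w₀ w = dominantFace (dualForm V) R w₀ w' := by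
  constructor
  · intro heq
    have h1 : w ∈ fanCone V x₀ R w₀ P w' := heq ▸ self_mem_fanCone hw
    have h2 : w' ∈ fanCone V x₀ R w₀ P w := heq ▸ self_mem_fanCone hw'
    exact ⟨(mem_ncone_maximizers_iff.1 h2.1).antisymm (mem_ncone_maximizers_iff.1 h1.1),
      dominantFace_congr fun α hα => ⟨h2.2.2 α hα, h1.2.2 α hα⟩⟩
  · rintro ⟨h1, h2⟩
    unfold fanCone
    rw [h1, h2]

theorem finite_dominantFaces (h : IsUnitRootSystem (dualForm V) s R w₀) :
    (dominantFace (dualForm V) R w₀ '' dominantCone (dualForm V) R w₀).Finite := by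
  have h1 : (Set.range fun Z : 𝒫 R => {v ∈ dominantCone (dualForm V) R w₀ |
      ∀ α ∈ positiveRoots (dualForm V) R w₀, α ∈ Z.1 → dualForm V α v = 0}).Finite :=
    have : Finite (𝒫 R) := h.finite.finite_subsets
    Set.finite_range _
  refine h1.subset ?_
  rintro _ ⟨w, hw, rfl⟩
  refine ⟨⟨{α ∈ R | dualForm V α w = 0}, fun _ h => h.1⟩, ?_⟩
  ext v
  exact ⟨fun hv => ⟨hv.1, fun α hα h0 => hv.2 α hα ⟨hα.1, h0⟩⟩,
    fun hv => ⟨hv.1, fun α hα h0 => hv.2 α hα h0.2⟩⟩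

/-- The hull of the top level together with the open half-space below it is convex and contains `A`,
hence contains the hull of `A`. -/
theorem mem_convexHull_of_pairing_eq {A : Set E} {w : DualSpace V} {c : ℝ}
    (hA : ∀ a ∈ A, pairing V x₀ w a ≤ c) {y : E} (hy : y ∈ convexHull ℝ A)
    (hyc : pairing V x₀ w y = c) :
    y ∈ convexHull ℝ {a ∈ A | pairing V x₀ w a = c} := by
  have hconv : Convex ℝ (convexHull ℝ {a ∈ A | pairing V x₀ w a = c} ∪
      {y | pairing V x₀ w y < c}) := by
    have hle : ∀ z ∈ convexHull ℝ {a ∈ A | pairing V x₀ w a = c} ∪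
        {y | pairing V x₀ w y < c}, pairing V x₀ w z ≤ c := by
      rintro z (hz | hz)
      · exact convexHull_min (fun a ha => ha.2.le) (convex_pairing_le w c) hz
      · exact le_of_lt hz
    rw [convex_iff_forall_pos]
    intro u hu v hv a b ha hb hab
    by_cases hlt : pairing V x₀ w u < c ∨ pairing V x₀ w v < c
    · right
      rw [Set.mem_ofPred_eq, pairing_combo w hab]
      have h3 : c = a * c + b * c := by rw [← add_mul, hab, one_mul]
      rw [h3]
      rcases hlt with h1 | h1
      · exact add_lt_add_of_lt_of_le (mul_lt_mul_of_pos_left h1 ha)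
          (mul_le_mul_of_nonneg_left (hle v hv) hb.le)
      · exact add_lt_add_of_le_of_lt (mul_le_mul_of_nonneg_left (hle u hu) ha.le)
          (mul_lt_mul_of_pos_left h1 hb)
    · push Not at hlt
      rcases hu with hu | hu
      · rcases hv with hv | hv
        · exact Or.inl (convex_convexHull ℝ _ hu hv ha.le hb.le hab)
        · exact absurd hv (not_lt.2 hlt.2)
      · exact absurd hu (not_lt.2 hlt.1)
  have hsub : A ⊆ convexHull ℝ {a ∈ A | pairing V x₀ w a = c} ∪
      {y | pairing V x₀ w y < c} := by
    intro a ha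
    rcases (hA a ha).eq_or_lt with h1 | h1
    · exact Or.inl (subset_convexHull ℝ _ ⟨ha, h1⟩)
    · exact Or.inr h1
  rcases convexHull_min hsub hconv hy with h1 | h1
  · exact h1
  · exact absurd hyc (ne_of_lt h1)

theorem IsPolytope.finite_maximizers (hP : IsPolytope V x₀ P) (hne : P.Nonempty) :
    (Set.range fun w => maximizers V x₀ w P).Finite := by
  have hmax := hP.maximizers_nonempty hne
  obtain ⟨s, hs, -, rfl⟩ := hP
  have h1 : (convexHull ℝ '' 𝒫 s).Finite := hs.finite_subsets.image _
  refine h1.subset ?_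
  rintro _ ⟨w, rfl⟩
  obtain ⟨x, hx⟩ := hmax w
  refine ⟨{a ∈ s | pairing V x₀ w a = pairing V x₀ w x}, fun _ h => h.1, ?_⟩
  apply Set.Subset.antisymm
  · intro y hy
    have hyP := convexHull_mono (fun _ h => h.1) hy
    refine ⟨hyP, fun z hz => (hx.2 z hz).trans_eq ?_⟩
    exact (convexHull_min (fun a ha => ha.2) (convex_pairing_eq w _) hy).symm
  · intro y hy
    exact mem_convexHull_of_pairing_eq (fun a ha => hx.2 a (subset_convexHull ℝ s ha)) hy.1
      (le_antisymm (hx.2 y hy.1) (hy.2 x hx.1))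

theorem IsPolytope.finite_fanCones (hP : IsPolytope V x₀ P) (hne : P.Nonempty)
    (h : IsUnitRootSystem (dualForm V) s R w₀) :
    (fanCone V x₀ R w₀ P '' dominantCone (dualForm V) R w₀).Finite := by
  refine (Set.Finite.image2 (fun F φ => ncone V x₀ F P ∩ φ) (hP.finite_maximizers hne)
    (finite_dominantFaces h)).subset ?_
  rintro _ ⟨w, hw, rfl⟩
  exact ⟨_, ⟨w, rfl⟩, _, ⟨w, hw, rfl⟩, rfl⟩

end FundamentalFan

/-! ### Faces of the symmetrization and their normal vectors. -/

section Faces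

open Filter Topology

variable {E : Type*} [NormedAddCommGroup E] [InnerProductSpace ℝ E] [FiniteDimensional ℝ E]

/-- A nonempty polytope in `U` whose points are strictly positive on all positive roots. -/
structure IsStrictlyDominant (V : Submodule ℝ E) (x₀ : E)
    (s : DualSpace V → DualSpace V ≃ₗ[ℝ] DualSpace V) (R : Set (DualSpace V))
    (w₀ : DualSpace V) (P : Set E) : Prop where
  perp : x₀ ∈ Vᗮ
  roots : IsUnitRootSystem (dualForm V) s R w₀
  polytope : IsPolytope V x₀ P
  nonempty : P.Nonempty
  pos : ∀ u ∈ P, ∀ α ∈ positiveRoots (dualForm V) R w₀,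
    0 < dualForm V α (Submodule.Quotient.mk u)

variable {V : Submodule ℝ E} {x₀ : E} {s : DualSpace V → DualSpace V ≃ₗ[ℝ] DualSpace V}
  {R : Set (DualSpace V)} {w₀ : DualSpace V} {P : Set E}

namespace IsStrictlyDominant

local notation "D" => dominantCone (dualForm V) R w₀
local notation "𝔊" => Subgroup.closure (s '' R)
local notation "Q" => symmetrization V x₀ (Subgroup.closure (s '' R)) P

theorem pairing_apply_le (h : IsStrictlyDominant V x₀ s R w₀ P) {g : DualSpace V ≃ₗ[ℝ] DualSpace V}
    (hg : g ∈ 𝔊) {w : DualSpace V} (hw : w ∈ D) {u : E} (hu : u ∈ P) :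
    pairing V x₀ (g w) u ≤ pairing V x₀ w u := by
  have hu' := h.polytope.subset hu
  rw [pairing_eq_dualForm h.perp _ hu', pairing_eq_dualForm h.perp _ hu']
  exact h.roots.form_apply_le hg hw (h.pos u hu)

theorem apply_eq_of_pairing_eq (h : IsStrictlyDominant V x₀ s R w₀ P)
    {g : DualSpace V ≃ₗ[ℝ] DualSpace V} (hg : g ∈ 𝔊) {w : DualSpace V} (hw : w ∈ D)
    {u : E} (hu : u ∈ P) (heq : pairing V x₀ (g w) u = pairing V x₀ w u) : g w = w := by
  have hu' := h.polytope.subset hu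
  rw [pairing_eq_dualForm h.perp _ hu', pairing_eq_dualForm h.perp _ hu'] at heq
  exact h.roots.apply_eq_of_form_eq hg hw (h.pos u hu) heq

theorem rightAct_mem_symmetrization {g : DualSpace V ≃ₗ[ℝ] DualSpace V} (hg : g ∈ 𝔊) {x : E}
    (hx : x ∈ P) : rightAct V x₀ x g ∈ Q :=
  subset_convexHull ℝ _ ⟨g, hg, x, hx, rfl⟩

theorem symmetrization_subset : Q ⊆ affineTranslate V x₀ := by
  refine convexHull_min ?_ convex_affineTranslate
  rintro _ ⟨g, -, x, -, rfl⟩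
  exact rightAct_mem _ _ _ _

theorem pairing_rightAct_apply (h : IsStrictlyDominant V x₀ s R w₀ P)
    (g k : DualSpace V ≃ₗ[ℝ] DualSpace V) (w : DualSpace V) {x : E} (hx : x ∈ P) :
    pairing V x₀ (g w) (rightAct V x₀ x k) = pairing V x₀ ((k * g) w) x := by
  rw [← pairing_rightAct _ _ _ _ (h.polytope.subset hx)]
  rfl

theorem pairing_le (h : IsStrictlyDominant V x₀ s R w₀ P) {g : DualSpace V ≃ₗ[ℝ] DualSpace V}
    (hg : g ∈ 𝔊) {w : DualSpace V} (hw : w ∈ D) {x : E} (hx : x ∈ maximizers V x₀ w P)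
    {y : E} (hy : y ∈ Q) : pairing V x₀ (g w) y ≤ pairing V x₀ w x := by
  refine convexHull_min ?_ (convex_pairing_le (g w) _) hy
  rintro _ ⟨k, hk, z, hz, rfl⟩
  rw [Set.mem_ofPred_eq, h.pairing_rightAct_apply g k w hz]
  exact (h.pairing_apply_le (mul_mem hk hg) hw hz).trans (hx.2 z hz)

theorem rightAct_inv_mem (h : IsStrictlyDominant V x₀ s R w₀ P)
    {g k : DualSpace V ≃ₗ[ℝ] DualSpace V} (hg : g ∈ 𝔊) (hk : k ∈ 𝔊) {w : DualSpace V}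
    (hw : w ∈ D) (hkw : k w = w) {x : E} (hx : x ∈ maximizers V x₀ w P) :
    rightAct V x₀ x (k * g⁻¹) ∈ maximizers V x₀ (g w) Q := by
  refine ⟨rightAct_mem_symmetrization (mul_mem hk (inv_mem hg)) hx.1, fun y hy => ?_⟩
  rw [h.pairing_rightAct_apply g _ w hx.1, inv_mul_cancel_right, hkw]
  exact h.pairing_le hg hw hx hy

/-- In `⟨g w, x k⟩ = ⟨k g w, x⟩ ≤ ⟨w, x⟩ ≤ max ⟨w, ·⟩` over `P`, maximality forces both inequalities
to be equalities; the first means `k g w = w`, the second that `x` is a maximizer. -/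
theorem rightAct_mem_maximizers_iff (h : IsStrictlyDominant V x₀ s R w₀ P)
    {g k : DualSpace V ≃ₗ[ℝ] DualSpace V} (hg : g ∈ 𝔊) (hk : k ∈ 𝔊) {w : DualSpace V}
    (hw : w ∈ D) {x : E} (hx : x ∈ P) :
    rightAct V x₀ x k ∈ maximizers V x₀ (g w) Q ↔
      x ∈ maximizers V x₀ w P ∧ (k * g) w = w := by
  constructor
  · intro h1
    obtain ⟨z, hz⟩ := h.polytope.maximizers_nonempty h.nonempty w
    have h2 := h.rightAct_inv_mem hg (one_mem _) hw rfl hz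
    have h3 := h1.2 _ h2.1
    rw [h.pairing_rightAct_apply g _ w hz.1, inv_mul_cancel_right,
      h.pairing_rightAct_apply g _ w hx] at h3
    have h4 := h.pairing_apply_le (mul_mem hk hg) hw hx
    have h5 := hz.2 x hx
    change pairing V x₀ w z ≤ _ at h3
    exact ⟨⟨hx, fun y hy => (hz.2 y hy).trans (h3.trans h4)⟩,
      h.apply_eq_of_pairing_eq (mul_mem hk hg) hw hx (le_antisymm h4 (h5.trans h3))⟩
  · rintro ⟨h1, h2⟩
    simpa using h.rightAct_inv_mem hg (mul_mem hk hg) hw h2 h1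

theorem mem_convexHull_of_mem_maximizers (h : IsStrictlyDominant V x₀ s R w₀ P)
    {g : DualSpace V ≃ₗ[ℝ] DualSpace V} (hg : g ∈ 𝔊) {w : DualSpace V} (hw : w ∈ D) {y : E}
    (hy : y ∈ maximizers V x₀ (g w) Q) :
    y ∈ convexHull ℝ {z | ∃ k ∈ 𝔊, (k * g) w = w ∧ ∃ x ∈ maximizers V x₀ w P,
      z = rightAct V x₀ x k} := by
  obtain ⟨x, hx⟩ := h.polytope.maximizers_nonempty h.nonempty w
  have hle : ∀ z ∈ Q, pairing V x₀ (g w) z ≤ pairing V x₀ w x := fun z hz =>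
    h.pairing_le hg hw hx hz
  have hxQ := hy.2 _ (h.rightAct_inv_mem hg (one_mem _) hw rfl hx).1
  rw [h.pairing_rightAct_apply g _ w hx.1, inv_mul_cancel_right] at hxQ
  refine convexHull_mono ?_ (mem_convexHull_of_pairing_eq (w := g w) (c := pairing V x₀ w x)
    (fun a ha => hle a (subset_convexHull ℝ _ ha)) hy.1 (le_antisymm (hle y hy.1) hxQ))
  rintro _ ⟨⟨k, hk, z, hz, rfl⟩, heq⟩
  have h1 : rightAct V x₀ z k ∈ maximizers V x₀ (g w) Q :=
    ⟨rightAct_mem_symmetrization hk hz, fun a ha => (hle a ha).trans_eq heq.symm⟩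
  obtain ⟨h2, h3⟩ := (h.rightAct_mem_maximizers_iff hg hk hw hz).1 h1
  exact ⟨k, hk, h3, z, h2, rfl⟩

theorem convex_maximizers_symmetrization (w : DualSpace V) : Convex ℝ (maximizers V x₀ w Q) := by
  intro u hu v hv a b ha hb hab
  refine ⟨convex_convexHull ℝ _ hu.1 hv.1 ha hb hab, fun y hy => ?_⟩
  rw [pairing_combo w hab]
  calc pairing V x₀ w y = a * pairing V x₀ w y + b * pairing V x₀ w y := by
        rw [← add_mul, hab, one_mul]
    _ ≤ _ := add_le_add (mul_le_mul_of_nonneg_left (hu.2 y hy) ha)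
        (mul_le_mul_of_nonneg_left (hv.2 y hy) hb)

theorem maximizers_congr (h : IsStrictlyDominant V x₀ s R w₀ P)
    {g : DualSpace V ≃ₗ[ℝ] DualSpace V} (hg : g ∈ 𝔊) {w w' : DualSpace V}
    (hw : w ∈ D) (hw' : w' ∈ D)
    (heq : fanCone V x₀ R w₀ P w = fanCone V x₀ R w₀ P w') :
    maximizers V x₀ (g w) Q = maximizers V x₀ (g w') Q := by
  have key : ∀ v v' : DualSpace V, v ∈ D → v' ∈ D →
      fanCone V x₀ R w₀ P v = fanCone V x₀ R w₀ P v' →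
      maximizers V x₀ (g v) Q ⊆ maximizers V x₀ (g v') Q := by
    intro v v' hv hv' hvv y hy
    obtain ⟨h1, h2⟩ := (fanCone_eq_iff hv hv').1 hvv
    refine convexHull_min ?_ (convex_maximizers_symmetrization (g v'))
      (h.mem_convexHull_of_mem_maximizers hg hv hy)
    rintro _ ⟨k, hk, hkv, x, hx, rfl⟩
    exact (h.rightAct_mem_maximizers_iff hg hk hv' hx.1).2
      ⟨h1 ▸ hx, (h.roots.stabilizer_eq_of_dominantFace hv hv' h2 (mul_mem hk hg)).1 hkv⟩
  exact (key w w' hw hw' heq).antisymm (key w' w hw' hw heq.symm)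

/-- For `j` fixing `w` and `x` maximal for `w`, the point `x (j g⁻¹)` lies on the common face. Read
from `w'`, this says that `x` is maximal for `w'` and `j g⁻¹ k` fixes `w'`. The case `j = 1` shows
that `g⁻¹ k` fixes `w'`, hence so does every such `j`; by symmetry the stabilizers coincide. -/
theorem eq_of_maximizers_eq (h : IsStrictlyDominant V x₀ s R w₀ P) {w w' : DualSpace V}
    (hw : w ∈ D) (hw' : w' ∈ D) {g k : DualSpace V ≃ₗ[ℝ] DualSpace V} (hg : g ∈ 𝔊)
    (hk : k ∈ 𝔊) (heq : maximizers V x₀ (g w) Q = maximizers V x₀ (k w') Q) :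
    g w = k w ∧ fanCone V x₀ R w₀ P w = fanCone V x₀ R w₀ P w' := by
  have key : ∀ {v v' : DualSpace V} {a b : DualSpace V ≃ₗ[ℝ] DualSpace V}, v ∈ D → v' ∈ D →
      a ∈ 𝔊 → b ∈ 𝔊 → maximizers V x₀ (a v) Q = maximizers V x₀ (b v') Q →
      ∀ x ∈ maximizers V x₀ v P, ∀ j ∈ 𝔊, j v = v →
        x ∈ maximizers V x₀ v' P ∧ (j * a⁻¹ * b) v' = v' := by
    intro v v' a b hv hv' ha hb hab x hx j hj hjv
    have h1 := h.rightAct_inv_mem ha hj hv hjv hx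
    rw [hab] at h1
    exact (h.rightAct_mem_maximizers_iff hb (mul_mem hj (inv_mem ha)) hv' hx.1).1 h1
  have h1 := key hw hw' hg hk heq
  have h2 := key hw' hw hk hg heq.symm
  obtain ⟨x, hx⟩ := h.polytope.maximizers_nonempty h.nonempty w
  obtain ⟨x', hx'⟩ := h.polytope.maximizers_nonempty h.nonempty w'
  have hgw : (k⁻¹ * g) w = w := by simpa using (h2 x' hx' 1 (one_mem _) rfl).2
  have hgw' : (g⁻¹ * k) w' = w' := by simpa using (h1 x hx 1 (one_mem _) rfl).2
  refine ⟨?_, (fanCone_eq_iff hw hw').2 ⟨?_, ?_⟩⟩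
  · have h3 : k ((k⁻¹ * g) w) = g w := k.apply_symm_apply (g w)
    rw [← h3, hgw]
  · exact Set.Subset.antisymm (fun x hx => (h1 x hx 1 (one_mem _) rfl).1)
      fun x hx => (h2 x hx 1 (one_mem _) rfl).1
  · refine h.roots.dominantFace_eq_of_stabilizer fun j hj => ⟨fun hjw => ?_, fun hjw => ?_⟩
    · simpa only [mul_assoc, LinearEquiv.mul_apply (f := j), hgw'] using (h1 x hx j hj hjw).2
    · simpa only [mul_assoc, LinearEquiv.mul_apply (f := j), hgw] using (h2 x' hx' j hj hjw).2

/-- The functionals that are constant on a face of the symmetrization are the differences of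
points of the corresponding cone of the fundamental fan. -/
theorem mem_vectorSpan_fanCone_iff (h : IsStrictlyDominant V x₀ s R w₀ P)
    {g : DualSpace V ≃ₗ[ℝ] DualSpace V} (hg : g ∈ 𝔊) {w : DualSpace V} (hw : w ∈ D) {v : DualSpace V} :
    v ∈ vectorSpan ℝ (fanCone V x₀ R w₀ P w) ↔
      ∀ y ∈ maximizers V x₀ (g w) Q, ∀ z ∈ maximizers V x₀ (g w) Q,
        pairing V x₀ (g v) y = pairing V x₀ (g v) z := by
  constructor
  · intro hv
    rw [vectorSpan_def] at hv
    obtain ⟨x, hx⟩ := h.polytope.maximizers_nonempty h.nonempty w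
    have hcone : ∀ u ∈ fanCone V x₀ R w₀ P w, ∀ y ∈ maximizers V x₀ (g w) Q,
        pairing V x₀ (g u) y = pairing V x₀ u x := by
      intro u hu y hy
      refine convexHull_min ?_ (convex_pairing_eq (g u) (pairing V x₀ u x))
        (h.mem_convexHull_of_mem_maximizers hg hw hy)
      rintro _ ⟨k, hk, hkw, a, ha, rfl⟩
      have h1 := h.roots.apply_eq_of_mem_dominantFace (mul_mem hk hg) hw hu.2 hkw
      rw [Set.mem_ofPred_eq, h.pairing_rightAct_apply g k u ha.1, h1]
      exact pairing_eq_of_mem_ncone hu.1 a ha x hx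
    intro y hy z hz
    induction hv using Submodule.span_induction with
    | mem u hu =>
      obtain ⟨u1, hu1, u2, hu2, rfl⟩ := hu
      simp only [vsub_eq_sub, map_sub, pairing_sub]
      rw [hcone u1 hu1 y hy, hcone u2 hu2 y hy, hcone u1 hu1 z hz, hcone u2 hu2 z hz]
    | zero => simp [pairing]
    | add a b _ _ ha hb => rw [map_add, pairing_add, pairing_add, ha, hb]
    | smul c a _ ha => rw [map_smul, pairing_smul, pairing_smul, ha]
  · intro hv
    obtain ⟨x, hx⟩ := h.polytope.maximizers_nonempty h.nonempty w
    have hconst : ∀ k ∈ 𝔊, k w = w → ∀ a ∈ maximizers V x₀ w P,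
        ∀ b ∈ maximizers V x₀ w P, pairing V x₀ (k v) a = pairing V x₀ v b := by
      intro k hk hkw a ha b hb
      have h1 := hv _ (h.rightAct_inv_mem hg hk hw hkw ha) _
        (h.rightAct_inv_mem hg (one_mem _) hw rfl hb)
      rw [h.pairing_rightAct_apply g _ v ha.1, h.pairing_rightAct_apply g _ v hb.1,
        inv_mul_cancel_right, inv_mul_cancel_right] at h1
      exact h1
    obtain ⟨ε, hε, hε0⟩ := ((h.polytope.eventually_mem_fanCone h.nonempty h.roots (u := v) hw
      (fun a ha b hb => hconst 1 (one_mem _) rfl a ha b hb)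
      (fun α hα h0 => by
        -- If `α` vanishes at `w`, then `s α` fixes `w`, so `v` and `s α v` agree at `x`, i.e. `2
        -- B(α,v) ⟨α,x⟩ = 0`. Strict positivity of `α` on `P` gives `B(α,v) = 0`.
        have h1 := hconst (s α) (Subgroup.subset_closure ⟨α, hα.1, rfl⟩)
          ((h.roots.refl_apply_eq_iff hα.1 w).2 h0) x hx x hx
        have hxU := h.polytope.subset hx.1
        rw [h.roots.refl α hα.1, pairing_sub, pairing_smul,
          pairing_eq_dualForm h.perp α hxU] at h1
        have h2 := h.pos x hx.1 α hα
        have h3 : 2 * dualForm V α v * dualForm V α (Submodule.Quotient.mk x) = 0 := by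
          linarith
        rcases mul_eq_zero.1 h3 with h4 | h4
        · linarith
        · exact absurd h4 h2.ne')).and self_mem_nhdsWithin).exists
    have hε1 : (0 : ℝ) < ε := hε0
    have h1 := vsub_mem_vectorSpan ℝ hε (self_mem_fanCone (x₀ := x₀) (P := P) hw)
    rw [vsub_eq_sub, add_sub_cancel_left] at h1
    have h2 := (vectorSpan ℝ (fanCone V x₀ R w₀ P w)).smul_mem ε⁻¹ h1
    rwa [smul_smul, inv_mul_cancel₀ hε1.ne', one_smul] at h2

/-- Duality of dimensions between a face and its normal cone. -/
theorem dim_fanCone_add_dim_maximizers (h : IsStrictlyDominant V x₀ s R w₀ P)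
    {g : DualSpace V ≃ₗ[ℝ] DualSpace V} (hg : g ∈ 𝔊) {w : DualSpace V} (hw : w ∈ D) :
    dim (fanCone V x₀ R w₀ P w) + dim (maximizers V x₀ (g w) Q)
      = Module.finrank ℝ (DualSpace V) := by
  have hle : vectorSpan ℝ (maximizers V x₀ (g w) Q) ≤ V := by
    rw [vectorSpan_def, Submodule.span_le]
    rintro _ ⟨y, hy, z, hz, rfl⟩
    have h1 : y - x₀ ∈ V := symmetrization_subset hy.1
    have h2 : z - x₀ ∈ V := symmetrization_subset hz.1
    have := V.sub_mem h1 h2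
    rwa [sub_sub_sub_cancel_right] at this
  let K : Submodule ℝ V := (vectorSpan ℝ (maximizers V x₀ (g w) Q)).comap V.subtype
  -- Under `W ≃ V`, the functionals constant on the face form the orthogonal complement of its
  -- direction space.
  have hK : (vectorSpan ℝ (fanCone V x₀ R w₀ P w)).map (g.trans (toV V)).toLinearMap = Kᗮ := by
    ext v
    have h1 : v ∈ (vectorSpan ℝ (fanCone V x₀ R w₀ P w)).map (g.trans (toV V)).toLinearMap ↔
        (g.trans (toV V)).symm v ∈ vectorSpan ℝ (fanCone V x₀ R w₀ P w) := by
      constructor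
      · rintro ⟨u, hu, rfl⟩
        rwa [LinearEquiv.coe_coe, LinearEquiv.symm_apply_apply]
      · exact fun hv => ⟨_, hv, (g.trans (toV V)).apply_symm_apply v⟩
    rw [h1, h.mem_vectorSpan_fanCone_iff hg hw, Submodule.mem_orthogonal']
    have hpair : ∀ y z : E, pairing V x₀ (g ((g.trans (toV V)).symm v)) y = pairing V x₀ (g ((g.trans (toV V)).symm v)) z ↔
        inner ℝ (v : E) (y - z) = 0 := by
      intro y z
      have h2 : toV V (g ((g.trans (toV V)).symm v)) = v := (g.trans (toV V)).apply_symm_apply v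
      unfold pairing
      rw [h2, ← sub_eq_zero, ← inner_sub_right,
        sub_sub_sub_cancel_right]
    constructor
    · intro hv u hu
      have hker : vectorSpan ℝ (maximizers V x₀ (g w) Q) ≤ LinearMap.ker (innerₗ E (v : E)) := by
        rw [vectorSpan_def, Submodule.span_le]
        rintro _ ⟨y, hy, z, hz, rfl⟩
        exact (hpair y z).1 (hv y hy z hz)
      exact hker hu
    · intro hv y hy z hz
      have h2 := vsub_mem_vectorSpan ℝ hy hz
      exact (hpair y z).2 (hv ⟨y - z, hle h2⟩ h2)
  have h3 : Module.finrank ℝ K = dim (maximizers V x₀ (g w) Q) :=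
    (Submodule.comapSubtypeEquivOfLe hle).finrank_eq
  have h4 : Module.finrank ℝ (Kᗮ : Submodule ℝ V) = dim (fanCone V x₀ R w₀ P w) := by
    rw [← hK]
    exact LinearEquiv.finrank_map_eq (g.trans (toV V)) _
  rw [← h3, ← h4, add_comm, Submodule.finrank_add_finrank_orthogonal]
  exact (toV V).finrank_eq.symm

theorem mem_faces_symmetrization_iff (h : IsStrictlyDominant V x₀ s R w₀ P)
    [Finite (Subgroup.closure (s '' R))] {F : Set E} :
    F ∈ faces V x₀ Q ↔ ∃ g ∈ 𝔊, ∃ w ∈ D, F = maximizers V x₀ (g w) Q := by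
  rw [mem_faces_iff]
  constructor
  · rintro ⟨w, -, rfl⟩
    obtain ⟨g, hg, hgw⟩ := h.roots.exists_apply_mem_dominantCone w
    refine ⟨g⁻¹, inv_mem hg, g w, hgw, ?_⟩
    rw [show g⁻¹ (g w) = w from g.symm_apply_apply w]
  · rintro ⟨g, hg, w, hw, rfl⟩
    obtain ⟨x, hx⟩ := h.polytope.maximizers_nonempty h.nonempty w
    exact ⟨g w, ⟨_, h.rightAct_inv_mem hg (one_mem _) hw rfl hx⟩, rfl⟩

end IsStrictlyDominant

end Faces

/-! ### Orbit counting and summation. -/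

section Counting

variable {E : Type*} [NormedAddCommGroup E] [InnerProductSpace ℝ E] [FiniteDimensional ℝ E]
  {V : Submodule ℝ E} {x₀ : E} {s : DualSpace V → DualSpace V ≃ₗ[ℝ] DualSpace V}
  {R : Set (DualSpace V)} {w₀ : DualSpace V} {P : Set E}

namespace IsStrictlyDominant

local notation "D" => dominantCone (dualForm V) R w₀
local notation "𝔊" => Subgroup.closure (s '' R)
local notation "Q" => symmetrization V x₀ (Subgroup.closure (s '' R)) P

theorem refinedFan_eq (h : IsStrictlyDominant V x₀ s R w₀ P) (φ : Set (DualSpace V)) :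
    refinedFan V x₀ D P φ
      = fanCone V x₀ R w₀ P '' {w ∈ D | dominantFace (dualForm V) R w₀ w = φ} := by
  ext τ
  unfold refinedFan
  rw [h.polytope.fundamentalFan_eq h.nonempty h.roots]
  constructor
  · rintro ⟨⟨w, hw, rfl⟩, hφ⟩
    exact ⟨w, ⟨hw, (isLeast_dominantFace h.roots hw).unique hφ⟩, rfl⟩
  · rintro ⟨w, ⟨hw, rfl⟩, rfl⟩
    exact ⟨⟨w, hw, rfl⟩, isLeast_dominantFace h.roots hw⟩

theorem stabilizer_dominantFace (h : IsUnitRootSystem (dualForm V) s R w₀) {w : DualSpace V}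
    (hw : w ∈ D) :
    MulAction.stabilizer 𝔊 (dominantFace (dualForm V) R w₀ w) = MulAction.stabilizer 𝔊 w := by
  ext g
  rw [MulAction.mem_stabilizer_iff, MulAction.mem_stabilizer_iff]
  exact h.smul_dominantFace_eq_iff hw g.2

/-- The faces of the symmetrization in the orbit of the face with normal vector `w`. -/
def orbitFaces (V : Submodule ℝ E) (x₀ : E) (G : Subgroup (DualSpace V ≃ₗ[ℝ] DualSpace V))
    (P : Set E) (w : DualSpace V) : Set (Set E) :=
  (fun v => maximizers V x₀ v (symmetrization V x₀ G P)) '' MulAction.orbit G w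

theorem mem_orbitFaces_iff {G : Subgroup (DualSpace V ≃ₗ[ℝ] DualSpace V)} {w : DualSpace V}
    {F : Set E} :
    F ∈ orbitFaces V x₀ G P w ↔
      ∃ g ∈ G, F = maximizers V x₀ (g w) (symmetrization V x₀ G P) := by
  constructor
  · rintro ⟨_, ⟨g, rfl⟩, rfl⟩
    exact ⟨g.1, g.2, rfl⟩
  · rintro ⟨g, hg, rfl⟩
    exact ⟨_, ⟨⟨g, hg⟩, rfl⟩, rfl⟩

theorem dim_add_eq_iff (h : IsStrictlyDominant V x₀ s R w₀ P) {w : DualSpace V} (hw : w ∈ D)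
    {F : Set E} (hF : F ∈ orbitFaces V x₀ 𝔊 P w) (i : ℕ) :
    dim (fanCone V x₀ R w₀ P w) + i = Module.finrank ℝ (DualSpace V) ↔ dim F = i := by
  obtain ⟨g, hg, rfl⟩ := mem_orbitFaces_iff.1 hF
  have := h.dim_fanCone_add_dim_maximizers hg hw
  omega

theorem orbitFaces_congr (h : IsStrictlyDominant V x₀ s R w₀ P) {w w' : DualSpace V}
    (hw : w ∈ D) (hw' : w' ∈ D) {F : Set E} (hF : F ∈ orbitFaces V x₀ 𝔊 P w)
    (hF' : F ∈ orbitFaces V x₀ 𝔊 P w') :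
    fanCone V x₀ R w₀ P w = fanCone V x₀ R w₀ P w' := by
  obtain ⟨g, hg, rfl⟩ := mem_orbitFaces_iff.1 hF
  obtain ⟨k, hk, heq⟩ := mem_orbitFaces_iff.1 hF'
  exact (h.eq_of_maximizers_eq hw hw' hg hk heq).2

variable [Finite (Subgroup.closure (s '' R))]

theorem orbitFaces_finite (w : DualSpace V) : (orbitFaces V x₀ 𝔊 P w).Finite :=
  (Set.finite_range fun g : 𝔊 => g • w).image _

/-- Distinct vectors of the orbit of `w` give distinct faces, so this is orbit-stabilizer, with the
pointwise stabilizer of `w` equal to the setwise stabilizer of its chamber face. -/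
theorem ncard_orbitFaces (h : IsStrictlyDominant V x₀ s R w₀ P) {w : DualSpace V}
    (hw : w ∈ D) :
    ((orbitFaces V x₀ 𝔊 P w).ncard : ℚ) = (Nat.card 𝔊 : ℚ) /
      (Nat.card (MulAction.stabilizer 𝔊 (dominantFace (dualForm V) R w₀ w)) : ℚ) := by
  have hinj : Set.InjOn (fun v => maximizers V x₀ v Q) (MulAction.orbit 𝔊 w) := by
    rintro _ ⟨g, rfl⟩ _ ⟨k, rfl⟩ heq
    change maximizers V x₀ (g.1 w) Q = maximizers V x₀ (k.1 w) Q at heq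
    exact (h.eq_of_maximizers_eq hw hw g.2 k.2 heq).1
  rw [orbitFaces, hinj.ncard_image, stabilizer_dominantFace h.roots hw]
  have h1 : (MulAction.orbit 𝔊 w).ncard * Nat.card (MulAction.stabilizer 𝔊 w)
      = Nat.card 𝔊 := by
    rw [← Nat.card_coe_set_eq, Nat.card_congr (MulAction.orbitEquivQuotientStabilizer 𝔊 w)]
    exact (Subgroup.card_eq_card_quotient_mul_card_subgroup _).symm
  rw [← h1, Nat.cast_mul, mul_div_assoc, div_self, mul_one]
  exact Nat.cast_ne_zero.2 Nat.card_pos.ne'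

/-- The faces of dimension `i` of the symmetrization that come from the face `φ` of the chamber. -/
def facesOver (V : Submodule ℝ E) (x₀ : E) (G : Subgroup (DualSpace V ≃ₗ[ℝ] DualSpace V))
    (R : Set (DualSpace V)) (w₀ : DualSpace V) (P : Set E) (i : ℕ) (φ : Set (DualSpace V)) :
    Set (Set E) :=
  {F | dim F = i ∧ ∃ w ∈ dominantCone (dualForm V) R w₀,
    dominantFace (dualForm V) R w₀ w = φ ∧ F ∈ orbitFaces V x₀ G P w}

/-- With one relative interior point chosen per cone, the orbits of faces are disjoint, of equal
size, and exhaust the faces over `φ`. -/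
theorem ncard_facesOver (h : IsStrictlyDominant V x₀ s R w₀ P) (i : ℕ)
    (φ : Set (DualSpace V)) :
    ((facesOver V x₀ 𝔊 R w₀ P i φ).ncard : ℚ) =
      (codimNumber V (refinedFan V x₀ D P φ) i : ℚ) *
        ((Nat.card 𝔊 : ℚ) / (Nat.card (MulAction.stabilizer 𝔊 φ) : ℚ)) := by
  let T : Set (Set (DualSpace V)) := {σ ∈ refinedFan V x₀ D P φ |
    dim σ + i = Module.finrank ℝ (DualSpace V)}
  have hT : T.Finite := by
    refine (h.polytope.finite_fanCones h.nonempty h.roots).subset ?_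
    rintro σ ⟨hσ, -⟩
    rw [h.refinedFan_eq] at hσ
    obtain ⟨w, hw, rfl⟩ := hσ
    exact ⟨w, hw.1, rfl⟩
  have hrep : ∀ σ ∈ T, ∃ w ∈ D, dominantFace (dualForm V) R w₀ w = φ ∧
      fanCone V x₀ R w₀ P w = σ := by
    rintro σ ⟨hσ, -⟩
    rw [h.refinedFan_eq] at hσ
    obtain ⟨w, hw, rfl⟩ := hσ
    exact ⟨w, hw.1, hw.2, rfl⟩
  choose! rep hrepD hrepφ hrepσ using hrep
  have hU : facesOver V x₀ 𝔊 R w₀ P i φ = ⋃ σ ∈ T, orbitFaces V x₀ 𝔊 P (rep σ) := by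
    ext F
    simp only [Set.mem_iUnion, exists_prop]
    constructor
    · rintro ⟨hi, w, hw, hwφ, hF⟩
      have hσ : fanCone V x₀ R w₀ P w ∈ T := by
        refine ⟨?_, (h.dim_add_eq_iff hw hF i).2 hi⟩
        rw [h.refinedFan_eq]
        exact ⟨w, ⟨hw, hwφ⟩, rfl⟩
      refine ⟨_, hσ, ?_⟩
      obtain ⟨g, hg, rfl⟩ := mem_orbitFaces_iff.1 hF
      exact mem_orbitFaces_iff.2 ⟨g, hg, h.maximizers_congr hg hw (hrepD _ hσ) (hrepσ _ hσ).symm⟩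
    · rintro ⟨σ, hσ, hF⟩
      refine ⟨(h.dim_add_eq_iff (hrepD σ hσ) hF i).1 ?_, rep σ, hrepD σ hσ, hrepφ σ hσ, hF⟩
      rw [hrepσ σ hσ]
      exact hσ.2
  have hdisj : T.PairwiseDisjoint fun σ => orbitFaces V x₀ 𝔊 P (rep σ) := by
    intro σ hσ τ hτ hne
    rw [Function.onFun, Set.disjoint_left]
    intro F hF hF'
    apply hne
    rw [← hrepσ σ hσ, ← hrepσ τ hτ]
    exact h.orbitFaces_congr (hrepD σ hσ) (hrepD τ hτ) hF hF'
  have hfin : ∀ σ ∈ T, (orbitFaces V x₀ 𝔊 P (rep σ)).Finite := fun σ _ =>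
    orbitFaces_finite (rep σ)
  rw [hU, hT.ncard_biUnion hfin hdisj,
    finsum_mem_eq_finite_toFinset_sum _ hT, Nat.cast_sum]
  have hc : ∀ σ ∈ hT.toFinset, ((orbitFaces V x₀ 𝔊 P (rep σ)).ncard : ℚ) =
      (Nat.card 𝔊 : ℚ) / (Nat.card (MulAction.stabilizer 𝔊 φ) : ℚ) := by
    intro σ hσ
    have hσT := (Set.Finite.mem_toFinset _).1 hσ
    rw [h.ncard_orbitFaces (hrepD σ hσT), hrepφ σ hσT]
  rw [Finset.sum_congr rfl hc, Finset.sum_const, nsmul_eq_mul]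
  congr 2
  exact (Set.ncard_eq_toFinset_card T hT).symm

theorem finite_faces_symmetrization (h : IsStrictlyDominant V x₀ s R w₀ P) :
    (faces V x₀ Q).Finite := by
  have hT := h.polytope.finite_fanCones h.nonempty h.roots
  have hrep : ∀ σ ∈ fanCone V x₀ R w₀ P '' D, ∃ w ∈ D, fanCone V x₀ R w₀ P w = σ :=
    fun σ hσ => hσ
  choose! rep hrepD hrepσ using hrep
  refine (hT.biUnion fun σ _ => orbitFaces_finite (x₀ := x₀) (s := s) (R := R) (P := P) (rep σ)).subset ?_
  intro F hF
  obtain ⟨g, hg, w, hw, rfl⟩ := h.mem_faces_symmetrization_iff.1 hF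
  have hσ : fanCone V x₀ R w₀ P w ∈ fanCone V x₀ R w₀ P '' D := ⟨w, hw, rfl⟩
  simp only [Set.mem_iUnion, exists_prop]
  exact ⟨_, hσ, mem_orbitFaces_iff.2
    ⟨g, hg, h.maximizers_congr hg hw (hrepD _ hσ) (hrepσ _ hσ).symm⟩⟩

theorem faceNumber_symmetrization (h : IsStrictlyDominant V x₀ s R w₀ P) (i : ℕ) :
    (faceNumber V x₀ Q i : ℚ) =
      ∑ᶠ φ ∈ {φ ∈ coneFaces V D | Module.finrank ℝ (DualSpace V) ≤ dim φ + i},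
        (codimNumber V (refinedFan V x₀ D P φ) i : ℚ) *
          ((Nat.card 𝔊 : ℚ) / (Nat.card (MulAction.stabilizer 𝔊 φ) : ℚ)) := by
  let I : Set (Set (DualSpace V)) :=
    {φ ∈ coneFaces V D | Module.finrank ℝ (DualSpace V) ≤ dim φ + i}
  have hI : I.Finite := by
    refine (finite_dominantFaces h.roots).subset ?_
    rw [← coneFaces_dominantCone h.roots]
    exact fun _ hφ => hφ.1
  have hU : {F ∈ faces V x₀ Q | dim F = i} = ⋃ φ ∈ I, facesOver V x₀ 𝔊 R w₀ P i φ := by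
    ext F
    simp only [Set.mem_iUnion, exists_prop]
    constructor
    · rintro ⟨hF, hi⟩
      obtain ⟨g, hg, w, hw, rfl⟩ := h.mem_faces_symmetrization_iff.1 hF
      have hF' : maximizers V x₀ (g w) Q ∈ orbitFaces V x₀ 𝔊 P w :=
        mem_orbitFaces_iff.2 ⟨g, hg, rfl⟩
      refine ⟨dominantFace (dualForm V) R w₀ w, ⟨?_, ?_⟩, hi, w, hw, rfl, hF'⟩
      · rw [coneFaces_dominantCone h.roots]
        exact ⟨w, hw, rfl⟩
      -- The bound `codim φ ≤ i` loses no face: the cone has codimension `i` and is contained in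
      -- `φ`.
      · rw [← (h.dim_add_eq_iff hw hF' i).2 hi]
        exact Nat.add_le_add_right
          (Submodule.finrank_mono (vectorSpan_mono ℝ Set.inter_subset_right)) i
    · rintro ⟨φ, -, hi, w, hw, -, hF⟩
      obtain ⟨g, hg, rfl⟩ := mem_orbitFaces_iff.1 hF
      exact ⟨h.mem_faces_symmetrization_iff.2 ⟨g, hg, w, hw, rfl⟩, hi⟩
  have hdisj : I.PairwiseDisjoint (facesOver V x₀ 𝔊 R w₀ P i) := by
    intro φ _ ψ _ hne
    rw [Function.onFun, Set.disjoint_left]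
    rintro F ⟨-, w, hw, rfl, hF⟩ ⟨-, w', hw', rfl, hF'⟩
    exact hne ((fanCone_eq_iff hw hw').1 (h.orbitFaces_congr hw hw' hF hF')).2
  have hfin : ∀ φ ∈ I, (facesOver V x₀ 𝔊 R w₀ P i φ).Finite := fun φ hφ =>
    h.finite_faces_symmetrization.subset fun F hF =>
      (hU.ge (Set.mem_biUnion hφ hF)).1
  rw [faceNumber, hU, hI.ncard_biUnion hfin hdisj, finsum_mem_eq_finite_toFinset_sum _ hI,
    Nat.cast_sum, finsum_mem_eq_finite_toFinset_sum _ hI]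
  exact Finset.sum_congr rfl fun φ _ => h.ncard_facesOver i φ

end IsStrictlyDominant

/-- A polytope inside the relative interior of the dual chamber is strictly positive on the
positive roots. -/
theorem form_pos_of_isAppropriate (hx₀ : x₀ ∈ Vᗮ) {u : E}
    (hu : u ∈ intrinsicInterior ℝ (dualChamber V x₀ (dominantCone (dualForm V) R w₀))) :
    ∀ α ∈ positiveRoots (dualForm V) R w₀, 0 < dualForm V α (Submodule.Quotient.mk u) := by
  have hmk : (Submodule.Quotient.mk (x₀ + (toV V w₀ : E)) : DualSpace V) = w₀ := by
    have h1 : (Submodule.Quotient.mk (x₀ + (toV V w₀ : E)) : DualSpace V)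
        = Submodule.Quotient.mk (toV V w₀ : E) := by
      rw [Submodule.Quotient.eq]
      simpa using hx₀
    rw [h1, ← (toV V).injective.eq_iff, toV_mk V (toV V w₀).2]
  have hv : x₀ + (toV V w₀ : E) ∈ dualChamber V x₀ (dominantCone (dualForm V) R w₀) := by
    refine ⟨?_, ?_⟩
    · change x₀ + (toV V w₀ : E) - x₀ ∈ V
      rw [add_sub_cancel_left]
      exact (toV V w₀).2
    · rw [hmk]
      exact fun α hα => hα.2.le
  -- Moving from `u` away from the point of class `w₀` stays in the dual chamber. Since `α` is
  -- positive at `w₀`, a nonpositive value at `u` would become negative.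
  obtain ⟨ε, hε, h1⟩ := exists_add_smul_sub_mem hu hv
  intro α hα
  have h2 := h1.2 α hα
  rw [Submodule.Quotient.mk_add, Submodule.Quotient.mk_smul, Submodule.Quotient.mk_sub, hmk,
    map_add, map_smul, map_sub, smul_eq_mul] at h2
  have h3 := hα.2
  by_contra! hneg
  nlinarith [mul_pos hε h3, mul_nonneg hε.le (neg_nonneg.2 hneg)]

theorem symmetrization_empty (G : Subgroup (DualSpace V ≃ₗ[ℝ] DualSpace V)) :
    symmetrization V x₀ G ∅ = ∅ := by
  simp [symmetrization]

theorem faces_empty : faces V x₀ ∅ = ∅ := by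
  ext F
  rw [mem_faces_iff]
  simp [maximizers]

theorem fundamentalFan_empty (Φ : Set (DualSpace V)) : fundamentalFan V x₀ Φ ∅ = ∅ := by
  simp [fundamentalFan, normalFan, faces_empty]

theorem refinedFan_empty (Φ φ : Set (DualSpace V)) : refinedFan V x₀ Φ ∅ φ = ∅ := by
  simp [refinedFan, fundamentalFan_empty]

end Counting

end Symmetrization

end

/-! ### The face-number formula. -/

open Symmetrization in
theorem mainTheorem8 {E : Type*} [NormedAddCommGroup E] [InnerProductSpace ℝ E]
    [FiniteDimensional ℝ E] (V : Submodule ℝ E) (x₀ : E) (hx₀ : x₀ ∈ Vᗮ)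
    (𝓗 : Set (Submodule ℝ (DualSpace V))) (h𝓗 : IsReflectionArrangement V 𝓗)
    (Φ : Set (DualSpace V)) (hΦ : IsChamber V 𝓗 Φ)
    (P : Set E) (hP : IsPolytope V x₀ P) (hplaced : IsPlaced V x₀ Φ P)
    (happropriate : IsAppropriate (dualChamber V x₀ Φ) P) :
    (faces V x₀ (symmetrization V x₀ (reflectionGroup V 𝓗) P)).Finite ∧
    (fundamentalFan V x₀ Φ P).Finite ∧
    (coneFaces V Φ).Finite ∧
    ∀ i : ℕ,
      (faceNumber V x₀ (symmetrization V x₀ (reflectionGroup V 𝓗) P) i : ℚ) =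
        ∑ᶠ φ ∈ {φ ∈ coneFaces V Φ | Module.finrank ℝ (DualSpace V) ≤ dim φ + i},
          (codimNumber V (refinedFan V x₀ Φ P φ) i : ℚ) *
            ((Nat.card (reflectionGroup V 𝓗) : ℚ) /
              (Nat.card (MulAction.stabilizer (reflectionGroup V 𝓗) φ) : ℚ)) := by
  obtain ⟨w₀, hroots, hΦ'⟩ := hΦ.exists_roots h𝓗
  have hD : Φ = dominantCone (dualForm V) (unitNormals V 𝓗) w₀ := hΦ'
  subst hD
  have hfinG : Finite (Subgroup.closure (rootReflection V '' unitNormals V 𝓗)) := by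
    rw [closure_rootReflections h𝓗.hyperplane]
    exact h𝓗.finite_group
  have hfaces : (coneFaces V (dominantCone (dualForm V) (unitNormals V 𝓗) w₀)).Finite := by
    rw [coneFaces_dominantCone hroots]
    exact finite_dominantFaces hroots
  rw [← closure_rootReflections h𝓗.hyperplane]
  -- The empty polytope has no nonempty faces, so both sides vanish; maximizers exist only for
  -- nonempty `P`.
  rcases P.eq_empty_or_nonempty with rfl | hne
  · rw [symmetrization_empty, fundamentalFan_empty, faces_empty]
    refine ⟨Set.finite_empty, Set.finite_empty, hfaces, fun i => ?_⟩
    simp [faceNumber, faces_empty, refinedFan_empty, codimNumber]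
  have h : IsStrictlyDominant V x₀ (rootReflection V) (unitNormals V 𝓗) w₀ P :=
    ⟨hx₀, hroots, hP, hne, fun u hu =>
      form_pos_of_isAppropriate hx₀ (happropriate hu)⟩
  refine ⟨h.finite_faces_symmetrization, ?_, hfaces, h.faceNumber_symmetrization⟩
  rw [hP.fundamentalFan_eq hne hroots]
  exact hP.finite_fanCones hne hroots
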